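/- **Theorem.** Computing a Hylland–Zeckhauser (HZ) equilibrium is in FIXP. An instance consists of $n$ agents, $n$ goods and rational utilities $u_{ij}$ (written in binary). A pair $(p,x)$ of prices $p\in\mathbb R^n$ and shares $x\in\mathbb R^{n\times n}$, $x_{ij}\ge 0$, is an *HZ equilibrium* if $\sum_i x_{ij}=1$ for every good $j$; $p_j\ge 0$ for every good $j$; and for every agent $i$ the bundle $x_i=(x_{ij})_j$ satisfies $\sum_j x_{ij}=1$ and $\sum_j p_jx_{ij}\le 1$ and maximizes $\sum_j u_{ij}y_j$ over all $y\ge 0$ with $\sum_j y_j=1$ and $\sum_j p_jy_j\le 1$. A *straight-line program* is a finite sequence of assignments to real registers, without branching, each of which assigns a rational constant or the result of one of the operations $+,-,\times,/,\min,\max$ applied to two registers; input and output vector are held in the same registers. A search problem whose solutions are real vectors is in *FIXP* if there is a polynomial-time algorithm that, given an instance $I$, outputs a system of rational linear inequalities whose solution set $D_I$ is nonempty, compact and convex, and a straight-line program of polynomial size that never divides by zero on inputs from $D_I$ and computes a continuous map $F_I:D_I\to D_I$, such that every fixed point of $F_I$ in $D_I$ is a solution of $I$. Moreover, for the HZ problem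 this holds with the domain of prices and allocations $$D_I=\Big\{(p,x)\;:\;0\le p_j\le n\ \text{for all } j,\quad x_{ij}\ge 0\ \text{for all } i,j,\quad \textstyle\sum_j x_{ij}=1\ \text{for all } i\Big\}.$$ -/

import Mathlib

namespace FixpHZ

/-! ### Words over a fixed finite alphabet -/

/-- The finite alphabet in which instances, linear systems and programs are written. -/
inductive Tok : Type
  | bit (b : Bool)
  | mark
  | minus
  | slash
  | item
  | sep
  | opConst
  | opAdd
  | opSub
  | opMul
  | opDiv
  | opMin
  | opMax
  deriving DecidableEq, Fintype

/-- A natural number in binary (least significant bit first, no leading zeros). -/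
def encBits (n : ℕ) : List Tok :=
  (Computability.encodeNat n).map Tok.bit

/-- A natural number in unary. Used for register names and for the number of agents; all numerical
data are written in binary. -/
def encUnary (n : ℕ) : List Tok :=
  List.replicate n Tok.mark ++ [Tok.sep]

/-- A rational number in lowest terms: sign, numerator in binary, denominator in binary. -/
def encRat (q : ℚ) : List Tok :=
  (if q.num < 0 then [Tok.minus] else []) ++
    (encBits q.num.natAbs ++ (Tok.slash :: (encBits q.den ++ [Tok.sep])))

/-- A finite list, given an encoding of its entries. -/
def encList {α : Type} (f : α → List Tok) : List α → List Tok
  | [] => [Tok.sep]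
  | a :: l => Tok.item :: (f a ++ encList f l)

/-! ### Straight-line programs over `ℝ` -/

/-- Instructions act on registers named by natural numbers. The first argument is the register that
receives the result; the others are a rational constant or the registers of the operands. -/
inductive Instr : Type
  | const (dst : ℕ) (q : ℚ)
  | add (dst a b : ℕ)
  | sub (dst a b : ℕ)
  | mul (dst a b : ℕ)
  | div (dst a b : ℕ)
  | min (dst a b : ℕ)
  | max (dst a b : ℕ)

/-- A straight-line program: a list of assignments, executed in order, without branching. -/
abbrev SLP : Type := List Instr

def encInstr : Instr → List Tok
  | .const d q => Tok.opConst :: (encUnary d ++ encRat q)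
  | .add d a b => Tok.opAdd :: (encUnary d ++ (encUnary a ++ encUnary b))
  | .sub d a b => Tok.opSub :: (encUnary d ++ (encUnary a ++ encUnary b))
  | .mul d a b => Tok.opMul :: (encUnary d ++ (encUnary a ++ encUnary b))
  | .div d a b => Tok.opDiv :: (encUnary d ++ (encUnary a ++ encUnary b))
  | .min d a b => Tok.opMin :: (encUnary d ++ (encUnary a ++ encUnary b))
  | .max d a b => Tok.opMax :: (encUnary d ++ (encUnary a ++ encUnary b))

/-- The contents of all registers. -/
abbrev Mem : Type := ℕ → ℝ

/-- The memory whose first `d` registers hold the vector `v`, all others being `0`. -/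
noncomputable def load {d : ℕ} (v : Fin d → ℝ) : Mem :=
  fun k => if h : k < d then v ⟨k, h⟩ else 0

/-- The effect of one instruction. -/
noncomputable def Instr.exec (m : Mem) : Instr → Mem
  | .const d q => Function.update m d (q : ℝ)
  | .add d a b => Function.update m d (m a + m b)
  | .sub d a b => Function.update m d (m a - m b)
  | .mul d a b => Function.update m d (m a * m b)
  | .div d a b => Function.update m d (m a / m b)
  | .min d a b => Function.update m d (Min.min (m a) (m b))
  | .max d a b => Function.update m d (Max.max (m a) (m b))

/-- The instruction does not divide by zero when executed in memory `m`. -/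
def Instr.Legal (m : Mem) : Instr → Prop
  | .div _ _ b => m b ≠ 0
  | _ => True

/-- The memory after execution of the whole program. -/
noncomputable def SLP.exec (m : Mem) : SLP → Mem
  | [] => m
  | c :: P => SLP.exec (c.exec m) P

/-- Started in memory `m`, the program never attempts to divide by zero. -/
def SLP.NoDivByZero (m : Mem) : SLP → Prop
  | [] => True
  | c :: P => c.Legal m ∧ SLP.NoDivByZero (c.exec m) P

/-- The function of `d` real variables computed by a program: input and output are in the first
`d` registers. -/
noncomputable def SLP.fn (P : SLP) (d : ℕ) (v : Fin d → ℝ) : Fin d → ℝ :=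
  fun k => SLP.exec (load v) P k

/-! ### Rational polyhedra -/

/-- A linear inequality `∑ c * v k ≤ rhs`, the sum being over the pairs `(k, c)` in `terms`. -/
structure LinIneq : Type where
  terms : List (ℕ × ℚ)
  rhs : ℚ

def encLinIneq (e : LinIneq) : List Tok :=
  encList (fun t : ℕ × ℚ => encUnary t.1 ++ encRat t.2) e.terms ++ encRat e.rhs

def LinIneq.Holds (e : LinIneq) {d : ℕ} (v : Fin d → ℝ) : Prop :=
  (e.terms.map fun t => (t.2 : ℝ) * load v t.1).sum ≤ (e.rhs : ℝ)

/-- The solution set in `ℝ^d` of a finite system of linear inequalities. -/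
def polyhedron (d : ℕ) (S : List LinIneq) : Set (Fin d → ℝ) :=
  {v | ∀ e ∈ S, e.Holds v}

/-- The word for a linear system together with a straight-line program. -/
def encOutput (o : List LinIneq × SLP) : List Tok :=
  encList encLinIneq o.1 ++ encList encInstr o.2

/-! ### The encodings lose no information -/

/-- `f` is a prefix code. -/
def PrefixCode {α : Type} (f : α → List Tok) : Prop :=
  ∀ a b s t, f a ++ s = f b ++ t → a = b ∧ s = t

theorem PrefixCode.injective {α : Type} {f : α → List Tok} (h : PrefixCode f) :
    Function.Injective f := fun a b hab => (h a b [] [] (by rw [hab])).1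

theorem encUnary_prefixCode : PrefixCode encUnary := by
  intro a
  induction a with
  | zero =>
    intro b s t h
    cases b <;> simp_all [encUnary, List.replicate_succ]
  | succ a ih =>
    intro b s t h
    cases b with
    | zero => simp [encUnary, List.replicate_succ] at h
    | succ b =>
      have := ih b s t (by simpa [encUnary, List.replicate_succ] using h)
      simpa using this

theorem map_bit_append (l l' : List Bool) (x y : Tok) (hx : ∀ b, x ≠ Tok.bit b)
    (hy : ∀ b, y ≠ Tok.bit b) (s t : List Tok)
    (h : l.map Tok.bit ++ x :: s = l'.map Tok.bit ++ y :: t) : l = l' ∧ s = t := by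
  induction l generalizing l' with
  | nil =>
    cases l' with
    | nil => simp_all
    | cons b l' => simp at h; exact absurd h.1 (hx b)
  | cons a l ih =>
    cases l' with
    | nil => simp at h; exact absurd h.1.symm (hy a)
    | cons b l' =>
      simp at h
      obtain ⟨h1, h2⟩ := ih l' (by simpa using h.2)
      exact ⟨by rw [h.1, h1], h2⟩

theorem encRat_prefixCode : PrefixCode encRat := by
  have key : ∀ (m d m' d' : ℕ) (s t : List Tok),
      encBits m ++ (Tok.slash :: (encBits d ++ (Tok.sep :: s))) =
        encBits m' ++ (Tok.slash :: (encBits d' ++ (Tok.sep :: t))) →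
      m = m' ∧ d = d' ∧ s = t := by
    intro m d m' d' s t h
    have inj : Function.Injective Computability.encodeNat :=
      Function.LeftInverse.injective Computability.decode_encodeNat
    obtain ⟨h1, h2⟩ := map_bit_append _ _ _ _ (by simp) (by simp) _ _ h
    obtain ⟨h3, h4⟩ := map_bit_append _ _ _ _ (by simp) (by simp) _ _ h2
    exact ⟨inj h1, inj h3, h4⟩
  have nominus : ∀ (m : ℕ) (r s : List Tok), encBits m ++ (Tok.slash :: r) ≠ Tok.minus :: s := by
    intro m r s h
    unfold encBits at h
    cases hm : Computability.encodeNat m <;> simp [hm] at h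
  intro a b s t h
  unfold encRat at h
  by_cases ha : a.num < 0 <;> by_cases hb : b.num < 0 <;>
    simp only [ha, hb, if_true, if_false, List.cons_append, List.nil_append, List.append_assoc] at h
  · obtain ⟨h1, h2, h3⟩ := key _ _ _ _ _ _ (List.cons.inj h).2
    exact ⟨Rat.ext (by omega) h2, h3⟩
  · exact absurd h.symm (nominus _ _ _)
  · exact absurd h (nominus _ _ _)
  · obtain ⟨h1, h2, h3⟩ := key _ _ _ _ _ _ h
    exact ⟨Rat.ext (by omega) h2, h3⟩

theorem encList_prefixCode {α : Type} {f : α → List Tok} (hf : PrefixCode f) :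
    PrefixCode (encList f) := by
  intro l
  induction l with
  | nil => intro l' s t h; cases l' <;> simp_all [encList]
  | cons a l ih =>
    intro l' s t h
    cases l' with
    | nil => simp [encList] at h
    | cons b l' =>
      simp only [encList, List.cons_append, List.append_assoc, List.cons.injEq, true_and] at h
      obtain ⟨h1, h2⟩ := hf _ _ _ _ h
      obtain ⟨h3, h4⟩ := ih _ _ _ h2
      exact ⟨by rw [h1, h3], h4⟩

theorem encInstr_prefixCode : PrefixCode encInstr := by
  intro a b s t h
  cases a <;> cases b <;>
    simp only [encInstr, List.cons_append, List.append_assoc, List.cons.injEq, reduceCtorEq,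
      false_and, true_and] at h
  case const.const =>
    obtain ⟨h1, h⟩ := encUnary_prefixCode _ _ _ _ h
    obtain ⟨h2, h⟩ := encRat_prefixCode _ _ _ _ h
    exact ⟨by rw [h1, h2], h⟩
  all_goals
    obtain ⟨h1, h⟩ := encUnary_prefixCode _ _ _ _ h
    obtain ⟨h2, h⟩ := encUnary_prefixCode _ _ _ _ h
    obtain ⟨h3, h⟩ := encUnary_prefixCode _ _ _ _ h
    exact ⟨by rw [h1, h2, h3], h⟩

theorem encLinIneq_prefixCode : PrefixCode encLinIneq := by
  rintro ⟨a, r⟩ ⟨b, r'⟩ s t h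
  simp only [encLinIneq, List.append_assoc] at h
  have hterm : PrefixCode (fun t : ℕ × ℚ => encUnary t.1 ++ encRat t.2) := by
    rintro ⟨k, c⟩ ⟨k', c'⟩ s t h
    simp only [List.append_assoc] at h
    obtain ⟨h1, h⟩ := encUnary_prefixCode _ _ _ _ h
    obtain ⟨h2, h⟩ := encRat_prefixCode _ _ _ _ h
    exact ⟨by rw [h1, h2], h⟩
  obtain ⟨h1, h⟩ := encList_prefixCode hterm _ _ _ _ h
  obtain ⟨h2, h⟩ := encRat_prefixCode _ _ _ _ h
  exact ⟨by rw [h1, h2], h⟩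

theorem encOutput_injective : Function.Injective encOutput := by
  rintro ⟨a, b⟩ ⟨a', b'⟩ h
  obtain ⟨h1, h2⟩ := encList_prefixCode encLinIneq_prefixCode _ _ _ _ h
  exact Prod.ext h1 ((encList_prefixCode encInstr_prefixCode).injective h2)

/-! ### The class FIXP -/

/-- A search problem whose solutions are real vectors. -/
structure RealSearchProblem : Type 1 where
  Instance : Type
  encode : Instance → List Tok
  encode_injective : Function.Injective encode
  dim : Instance → ℕ
  Sol : (I : Instance) → Set (Fin (dim I) → ℝ)

/-- `P` is in FIXP by means of fixed points on the domains `D I`: some function computable by a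
Turing machine in polynomial time maps every instance `I` to a system of linear inequalities whose
solution set is the nonempty, compact, convex set `D I`, and to a straight-line program of
polynomial size which, started at any point of `D I`, never divides by zero, which computes a
continuous map of `D I` to itself, and each of whose fixed points in `D I` is a solution of `I`. -/
def RealSearchProblem.InFIXPOn (P : RealSearchProblem)
    (D : (I : P.Instance) → Set (Fin (P.dim I) → ℝ)) : Prop :=
  ∃ g : P.Instance → List LinIneq × SLP,
    Nonempty (Turing.TM2ComputableInPolyTime P.encode encOutput g) ∧
    (∃ q : Polynomial ℕ, ∀ I, (g I).2.length ≤ q.eval (P.encode I).length) ∧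
    ∀ I : P.Instance,
      D I = polyhedron (P.dim I) (g I).1 ∧
      (D I).Nonempty ∧ IsCompact (D I) ∧ Convex ℝ (D I) ∧
      (∀ v ∈ D I, SLP.NoDivByZero (load v) (g I).2) ∧
      Set.MapsTo (SLP.fn (g I).2 (P.dim I)) (D I) (D I) ∧
      ContinuousOn (SLP.fn (g I).2 (P.dim I)) (D I) ∧
      ∀ v ∈ D I, SLP.fn (g I).2 (P.dim I) v = v → v ∈ P.Sol I

/-- Membership in FIXP. -/
def RealSearchProblem.InFIXP (P : RealSearchProblem) : Prop :=
  ∃ D : (I : P.Instance) → Set (Fin (P.dim I) → ℝ), P.InFIXPOn D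

/-! ### The Hylland-Zeckhauser scheme -/

/-- `x i j` is the probability share of good `j` allocated to agent `i`, `p j` the price of good
`j`, `u i j` the utility of agent `i` for good `j`; every agent has one dollar. -/
structure IsHZEquilibrium {n : ℕ} (u : Fin n → Fin n → ℝ) (p : Fin n → ℝ)
    (x : Fin n → Fin n → ℝ) : Prop where
  share_nonneg : ∀ i j, 0 ≤ x i j
  good_sold : ∀ j, ∑ i, x i j = 1
  size_eq_one : ∀ i, ∑ j, x i j = 1
  price_nonneg : ∀ j, 0 ≤ p j
  cost_le_one : ∀ i, ∑ j, p j * x i j ≤ 1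
  optimal : ∀ i, ∀ y : Fin n → ℝ, (∀ j, 0 ≤ y j) → ∑ j, y j = 1 → ∑ j, p j * y j ≤ 1 →
    ∑ j, u i j * y j ≤ ∑ j, u i j * x i j

/-- An instance: the number of agents (and goods) and the rational utilities. -/
abbrev HZInstance : Type := Σ n : ℕ, (Fin n → Fin n → ℚ)

/-- The number of agents, followed by the utilities, row by row. -/
def encHZ (I : HZInstance) : List Tok :=
  encUnary I.1 ++
    (List.finRange I.1).flatMap fun i => (List.finRange I.1).flatMap fun j => encRat (I.2 i j)

theorem flatMap_prefix {ι : Type} (L : List ι) (f g : ι → List Tok)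
    (Q : ι → Prop) (h : ∀ i s t, f i ++ s = g i ++ t → Q i ∧ s = t) :
    ∀ s t, L.flatMap f ++ s = L.flatMap g ++ t → (∀ i ∈ L, Q i) ∧ s = t := by
  induction L with
  | nil => intro s t hst; simpa using hst
  | cons a L ih =>
    intro s t hst
    simp only [List.flatMap_cons, List.append_assoc] at hst
    obtain ⟨h1, h2⟩ := h _ _ _ hst
    obtain ⟨h3, h4⟩ := ih _ _ h2
    exact ⟨by simpa using ⟨h1, h3⟩, h4⟩

theorem encHZ_injective : Function.Injective encHZ := by
  rintro ⟨n, u⟩ ⟨n', u'⟩ h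
  obtain ⟨rfl, h⟩ := encUnary_prefixCode _ _ _ _ h
  have h2 := flatMap_prefix (List.finRange n) _ _
    (fun i => ∀ j ∈ List.finRange n, u i j = u' i j)
    (fun i s t hi => flatMap_prefix (List.finRange n) _ _ (fun j => u i j = u' i j)
      (fun j s t hj => encRat_prefixCode _ _ s t hj) s t hi) [] [] (by simpa using h)
  have : u = u' := by
    funext i j
    exact h2.1 i (List.mem_finRange i) j (List.mem_finRange j)
  rw [this]

/-- The prices are the first `n` coordinates of a vector in `ℝ^(n + n * n)`. -/
def priceOf {n : ℕ} (v : Fin (n + n * n) → ℝ) : Fin n → ℝ :=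
  fun j => v (Fin.castAdd (n * n) j)

/-- The remaining coordinates are the allocation, row by row. -/
def allocOf {n : ℕ} (v : Fin (n + n * n) → ℝ) : Fin n → Fin n → ℝ :=
  fun i j => v (Fin.natAdd n (finProdFinEquiv (i, j)))

/-- The problem of computing Hylland-Zeckhauser equilibrium prices and allocations. -/
def hzProblem : RealSearchProblem where
  Instance := HZInstance
  encode := encHZ
  encode_injective := encHZ_injective
  dim I := I.1 + I.1 * I.1
  Sol I := {v | IsHZEquilibrium (fun i j => (I.2 i j : ℝ)) (priceOf v) (allocOf v)}

/-- All prices in `[0, n]`, and every agent's bundle a probability vector. -/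
def hzDomain (I : HZInstance) : Set (Fin (I.1 + I.1 * I.1) → ℝ) :=
  {v | (∀ j, 0 ≤ priceOf v j ∧ priceOf v j ≤ I.1) ∧
    ∀ i, (∀ j, 0 ≤ allocOf v i j) ∧ ∑ j, allocOf v i j = 1}

end FixpHZ

namespace FixpHZ

open Turing

/-! ### Structured stack programs and their compilation to Turing machines -/

/-! Prices: each price moves by the excess demand of its good and is truncated to `[0, n]`; then the
least result `t` (at most `n`) is subtracted from all. At a fixed point `t = 0`, since a positive
`t` would be at most the excess demand of every good, while excess demands sum to 0. So, for `n >
0`, some good is free. Once all bundles are affordable, a good in excess demand would have price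
`n`, and its buyers would spend more than the `n` dollars available. Hence no excess demand is
positive, and all markets clear (`isHZEquilibrium_of_fixed`).

Bundles: `y` is pushed towards affordable bundles of at most two goods. With `s = max (1 - p b) 0`
and `r = max (p c - 1) 0`, the mixture `s e_c + r e_b` has cost equal to its size if `p b < 1 < p
c`, and is a multiple of the affordable good `c` if `p c ≤ 1`. Its weight is `s` times (positive
part of its utility gain + excess cost of `y`). If normalization returns `y`, the weighted sum of
the mixtures is a multiple of `y`, so every linear functional yields an identity
(`sum_mixWeight_mul_eq_zero`). For the functional `p` it forces affordability, thanks to the free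
good (`cost_le_one_of_fixed`). For `u` it then becomes a vanishing sum of terms `s * (gain⁺)^2`, so
no mixture improves `y`, and linear programming duality gives optimality among all affordable
bundles (`optimal_of_fixed`).

Computability: the utilities enter only through instructions that load constants; the linear system
and the rest of the program depend on `n` alone. So the machine needs no arithmetic on binary
numbers: it copies the encoded utilities verbatim and produces everything else by nested counting
loops. Generators of words are compiled to stack programs, and these to Turing machines, with
explicit step bounds (`Gen.runs_cmd`, `computable_of_tableWord`). The straight-line program is
verified by a calculus of preconditions (`Valid`, `valid_mainProg`). -/

/-- Structured programs acting on stacks of tokens. `loop k f c` repeats `c` as long as stack `k`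
has a top token that satisfies `f`. -/
inductive Cmd (K : Type) : Type
  | push (k : K) (t : Tok)
  | pop (k : K)
  | move (k k' : K)
  | seq (c c' : Cmd K)
  | loop (k : K) (f : Tok → Bool) (c : Cmd K)

namespace Cmd

variable {K : Type}

/-- The labels used by the machine code of a program. -/
def Label : Cmd K → Type
  | push _ _ => Unit
  | pop _ => Unit
  | move _ _ => Unit
  | seq c c' => c.Label ⊕ c'.Label
  -- `none` is the test at the head of the loop.
  | loop _ _ c => Option c.Label

instance instFintypeLabel : (c : Cmd K) → Fintype c.Label
  | push _ _ => inferInstanceAs (Fintype Unit)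
  | pop _ => inferInstanceAs (Fintype Unit)
  | move _ _ => inferInstanceAs (Fintype Unit)
  | seq c c' =>
    let _ := instFintypeLabel c
    let _ := instFintypeLabel c'
    inferInstanceAs (Fintype (c.Label ⊕ c'.Label))
  | loop _ _ c =>
    let _ := instFintypeLabel c
    inferInstanceAs (Fintype (Option c.Label))

/-- The label at which the machine code of a program starts. -/
def entry : (c : Cmd K) → c.Label
  | push _ _ => ()
  | pop _ => ()
  | move _ _ => ()
  | seq c _ => Sum.inl c.entry
  | loop _ _ _ => (none : Option _)

/-- The machine code of a program, with its labels renamed by `emb`, which ends by a jump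
to `exit`. -/
def code {Λ : Type} : (c : Cmd K) → (c.Label → Λ) → Λ → c.Label →
    TM2.Stmt (fun _ : K => Tok) Λ (Option Tok)
  | push k t, _, exit, _ => .push k (fun _ => t) (.goto fun _ => exit)
  | pop k, _, exit, _ => .pop k (fun s _ => s) (.goto fun _ => exit)
  | move k k', _, exit, _ =>
    -- The default `Tok.sep` is pushed only if stack `k` is empty, a case that `runs_move` excludes.
    .pop k (fun _ o => o) (.push k' (fun s => s.getD Tok.sep) (.goto fun _ => exit))
  | seq c c', emb, exit, l =>
    Sum.elim (c.code (fun l => emb (Sum.inl l)) (emb (Sum.inr c'.entry)))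
      (c'.code (fun l => emb (Sum.inr l)) exit) l
  | loop k f c, emb, exit, l =>
    Option.elim l
      (.peek k (fun _ o => o)
        (.branch (fun s => s.any f) (.goto fun _ => emb (some c.entry)) (.goto fun _ => exit)))
      (c.code (fun l => emb (some l)) (emb none))

end Cmd

/-- `f` leads from `a` to `b` in at most `t` steps. -/
def LeadsIn {σ : Type} (f : σ → Option σ) (t : ℕ) (a b : σ) : Prop :=
  ∃ s ≤ t, (flip bind f)^[s] (some a) = some b

theorem LeadsIn.trans {σ : Type} {f : σ → Option σ} {t t' : ℕ} {a b c : σ}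
    (h : LeadsIn f t a b) (h' : LeadsIn f t' b c) : LeadsIn f (t + t') a c := by
  obtain ⟨s, hs, e⟩ := h
  obtain ⟨s', hs', e'⟩ := h'
  exact ⟨s' + s, by omega, by rw [Function.iterate_add_apply, e, e']⟩

theorem LeadsIn.single {σ : Type} {f : σ → Option σ} {a b : σ} (h : f a = some b) :
    LeadsIn f 1 a b := ⟨1, le_rfl, h⟩

theorem LeadsIn.mono {σ : Type} {f : σ → Option σ} {t t' : ℕ} {a b : σ}
    (h : LeadsIn f t a b) (htt' : t ≤ t') : LeadsIn f t' a b := by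
  obtain ⟨s, hs, e⟩ := h
  exact ⟨s, hs.trans htt', e⟩

namespace Cmd

variable {K : Type} [DecidableEq K]

/-- Started with stacks `S`, the program `c` ends with stacks `S'` after at most `t` steps. -/
def Runs (c : Cmd K) (S S' : K → List Tok) (t : ℕ) : Prop :=
  -- Quantifying over every surrounding machine makes runs composable. The internal state may be
  -- arbitrary at the start and is left unspecified at the end, because each command that uses it
  -- sets it beforehand.
  ∀ (Λ : Type) (M : Λ → TM2.Stmt (fun _ : K => Tok) Λ (Option Tok)) (emb : c.Label → Λ)
    (exit : Λ), (∀ l, M (emb l) = c.code emb exit l) → ∀ s, ∃ s',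
      LeadsIn (TM2.step M) t ⟨some (emb c.entry), s, S⟩ ⟨some exit, s', S'⟩

theorem Runs.mono {c : Cmd K} {S S' : K → List Tok} {t t' : ℕ} (h : c.Runs S S' t)
    (htt' : t ≤ t') : c.Runs S S' t' := by
  intro Λ M emb exit hM s
  obtain ⟨s', hs'⟩ := h Λ M emb exit hM s
  exact ⟨s', hs'.mono htt'⟩

theorem runs_push (k : K) (t : Tok) (S : K → List Tok) :
    (push k t).Runs S (Function.update S k (t :: S k)) 1 := by
  intro Λ M emb exit hM s
  exact ⟨s, LeadsIn.single (by rw [TM2.step, hM]; rfl)⟩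

theorem runs_pop (k : K) (S : K → List Tok) :
    (pop k).Runs S (Function.update S k (S k).tail) 1 := by
  intro Λ M emb exit hM s
  exact ⟨s, LeadsIn.single (by rw [TM2.step, hM]; rfl)⟩

theorem runs_move {k k' : K} {S : K → List Tok} {t : Tok} {l : List Tok} (hk : S k = t :: l)
    (hkk' : k' ≠ k) :
    (move k k').Runs S (Function.update (Function.update S k l) k' (t :: S k')) 1 := by
  intro Λ M emb exit hM s
  refine ⟨some t, LeadsIn.single ?_⟩
  rw [TM2.step, hM]
  simp [code, hk, Function.update_of_ne hkk']

theorem Runs.seq {c c' : Cmd K} {S S' S'' : K → List Tok} {t t' : ℕ} (h : c.Runs S S' t)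
    (h' : c'.Runs S' S'' t') : (c.seq c').Runs S S'' (t + t') := by
  intro Λ M emb exit hM s
  obtain ⟨s', hs'⟩ := h Λ M (fun l => emb (Sum.inl l)) (emb (Sum.inr c'.entry))
    (fun l => hM (Sum.inl l)) s
  obtain ⟨s'', hs''⟩ := h' Λ M (fun l => emb (Sum.inr l)) exit (fun l => hM (Sum.inr l)) s'
  exact ⟨s'', hs'.trans hs''⟩

theorem runs_loop_done {k : K} {f : Tok → Bool} {c : Cmd K} {S : K → List Tok}
    (h : (S k).head?.any f = false) : (loop k f c).Runs S S 1 := by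
  intro Λ M emb exit hM s
  refine ⟨(S k).head?, LeadsIn.single ?_⟩
  have : (loop k f c).entry = (none : Option c.Label) := rfl
  rw [TM2.step, hM, this]
  simp [code, h]

theorem Runs.loop {k : K} {f : Tok → Bool} {c : Cmd K} {S S' S'' : K → List Tok} {t t' : ℕ}
    (h : (S k).head?.any f = true) (hc : c.Runs S S' t) (hl : (c.loop k f).Runs S' S'' t') :
    (c.loop k f).Runs S S'' (1 + t + t') := by
  intro Λ M emb exit hM s
  have hentry : (Cmd.loop k f c).entry = (none : Option c.Label) := rfl
  have h1 : LeadsIn (TM2.step M) 1 ⟨some (emb (Cmd.loop k f c).entry), s, S⟩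
      ⟨some (emb (some c.entry)), (S k).head?, S⟩ := by
    refine LeadsIn.single ?_
    rw [TM2.step, hM, hentry]
    simp [code, h]
  obtain ⟨s', hs'⟩ := hc Λ M (fun l => emb (some l)) (emb none) (fun l => hM (some l)) (S k).head?
  obtain ⟨s'', hs''⟩ := hl Λ M emb exit hM s'
  exact ⟨s'', (h1.trans hs').trans hs''⟩

/-- The Turing machine that executes a program and halts. -/
def machine [Fintype K] (c : Cmd K) (inp out : K) : FinTM2 where
  K := K
  k₀ := inp
  k₁ := out
  Γ := fun _ => Tok
  Λ := Option c.Label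
  main := some c.entry
  σ := Option Tok
  initialState := none
  Γk₀Fin := inferInstanceAs (Fintype Tok)
  -- The extra label `none` resets the internal state before halting, as `haltList` requires.
  m := fun l => Option.elim l (.load (fun _ => none) .halt) (c.code some none)

/-- `haltList` prescribes all stacks, so every stack except the output must end empty. The
additional step is the halt. -/
theorem machine_outputs [Fintype K] {c : Cmd K} {inp out : K} {w w' : List Tok} {t : ℕ}
    (h : c.Runs (fun k : K => if k = inp then w else [])
      (fun k : K => if k = out then w' else []) t) :
    Nonempty (TM2OutputsInTime (c.machine inp out) w (some w') (t + 1)) := by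
  obtain ⟨s', hs'⟩ := h (Option c.Label) (c.machine inp out).m some none (fun l => rfl) none
  have hlast : LeadsIn (TM2.step (c.machine inp out).m) 1
      ⟨some none, s', fun k : K => if k = out then w' else []⟩
      ⟨none, none, fun k : K => if k = out then w' else []⟩ := LeadsIn.single rfl
  obtain ⟨n, hn, e⟩ := hs'.trans hlast
  have hinit : initList (c.machine inp out) w =
      ⟨some (some c.entry), none, fun k : K => if k = inp then w else []⟩ := by
    unfold initList
    congr 1
  have hhalt : haltList (c.machine inp out) w' =
      ⟨none, none, fun k : K => if k = out then w' else []⟩ := by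
    unfold haltList
    congr 1
  refine ⟨⟨⟨n, ?_⟩, hn⟩⟩
  rw [hinit]
  exact e.trans (congrArg some hhalt.symm)

end Cmd

/-! ### Elementary loops -/

namespace Cmd

variable {K : Type} [DecidableEq K]

/-- The loop condition that always holds. -/
def anyTok : Tok → Bool := fun _ => true

/-- Removes all tokens from a stack. -/
def clear (k : K) : Cmd K := loop k anyTok (pop k)

theorem runs_clear (k : K) (S : K → List Tok) :
    (clear k).Runs S (Function.update S k []) (2 * (S k).length + 1) := by
  obtain ⟨l, hl⟩ : ∃ l, S k = l := ⟨_, rfl⟩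
  rw [hl]
  induction l generalizing S with
  | nil =>
    have h1 : Function.update S k [] = S := by rw [← hl, Function.update_eq_self]
    rw [h1]
    exact runs_loop_done (by simp [hl])
  | cons t l ih =>
    have h1 := runs_pop k S
    have h2 := ih (Function.update S k (S k).tail) (by simp [hl])
    rw [Function.update_idem] at h2
    exact (h1.loop (by simp [hl, anyTok]) h2).mono (by simp; omega)

/-- Tokens go one by one from top to top, so the prefix arrives reversed. Each token costs a test
and a move; one last test ends the loop. -/
theorem runs_transfer {k k' : K} (hkk' : k' ≠ k) {f : Tok → Bool} {S : K → List Tok}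
    {l r : List Tok} (hS : S k = l ++ r) (hl : ∀ t ∈ l, f t = true)
    (hr : r.head?.any f = false) :
    (loop k f (move k k')).Runs S
      (Function.update (Function.update S k r) k' (l.reverse ++ S k')) (2 * l.length + 1) := by
  induction l generalizing S with
  | nil =>
    have h1 : Function.update S k r = S := by
      rw [← List.nil_append r, ← hS, Function.update_eq_self]
    simp only [List.reverse_nil, List.nil_append, h1, Function.update_eq_self]
    exact runs_loop_done (by simpa [hS] using hr)
  | cons t l ih =>
    have h1 := runs_move (S := S) (l := l ++ r) hS hkk'
    have h2 := ih (S := Function.update (Function.update S k (l ++ r)) k' (t :: S k'))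
      (by simp [Function.update_of_ne hkk'.symm]) (fun t ht => hl t (by simp [ht]))
    have h3 := h1.loop (k := k) (f := f) (by simp [hS, hl t]) h2
    have h4 : Function.update (Function.update (Function.update (Function.update S k (l ++ r)) k'
        (t :: S k')) k r) k' (l.reverse ++ Function.update (Function.update S k (l ++ r)) k'
        (t :: S k') k') =
        Function.update (Function.update S k r) k' ((t :: l).reverse ++ S k') := by
      funext x
      by_cases hx : x = k'
      · simp [hx]
      · by_cases hx' : x = k <;> simp [Function.update_apply, hx, hx']
    rw [h4] at h3
    exact h3.mono (by simp; omega)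

end Cmd

/-! ### Generators of words -/

/-- The variables of a word generator. -/
inductive Var : Type
  | size
  | agent
  | good
  | low
  | high
  | count
  | aux
  | aux₂
  deriving DecidableEq

instance : Fintype Var :=
  ⟨{.size, .agent, .good, .low, .high, .count, .aux, .aux₂}, by intro x; cases x <;> decide⟩

/-- Generators of words. In `loop i v g` the variable `i` runs through all numbers less than the
value of `v`. -/
inductive Gen : Type
  | tok (t : Tok)
  | seq (g g' : Gen)
  | loop (i v : Var) (g : Gen)

/-- `val v` holds the value of a variable, `rem v` the number of iterations still to be done in the
loop over `v`, `acc` the reversal of the word generated so far. -/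
inductive Stk : Type
  | val (v : Var)
  | rem (v : Var)
  | tmp
  | inp
  | acc
  | out
  deriving DecidableEq, Fintype

namespace Gen

/-- The word generated for given values of the variables. -/
def word : Gen → (Var → ℕ) → List Tok
  | tok t, _ => [t]
  | seq g g', e => g.word e ++ g'.word e
  | loop i v g, e => (List.range (e v)).flatMap fun k => g.word (Function.update e i k)

/-- No loop uses a variable that is already in use. -/
def wf : Gen → List Var → Bool
  | tok _, _ => true
  | seq g g', L => g.wf L && g'.wf L
  | loop i v g, L => decide (i ∉ L) && (decide (v ∈ L) && g.wf (i :: L))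

/-- A bound for the number of steps needed to generate the word, in terms of a bound for the
values of the variables. -/
noncomputable def cost : Gen → Polynomial ℕ
  | tok _ => 1
  | seq g g' => g.cost + g'.cost
  -- Besides the body, an iteration accounts for 5 steps of copying the bound, 3 for test, pop and
  -- push, and 2 for clearing the counter; 11 leaves slack.
  | loop _ _ g => Polynomial.X * (g.cost + 11) + 4

theorem update_le {e : Var → ℕ} {N k : ℕ} (he : ∀ v, e v ≤ N) (hk : k ≤ N) (i : Var) (v : Var) :
    Function.update e i k v ≤ N := by
  by_cases hv : v = i
  · simpa [hv] using hk
  · simpa [hv] using he v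

/-- Every token costs at least one step, so the step bound also bounds the length; this later yields
the polynomial size of the program. -/
theorem length_word_le (g : Gen) {e : Var → ℕ} {N : ℕ} (he : ∀ v, e v ≤ N) :
    (g.word e).length ≤ g.cost.eval N := by
  induction g generalizing e with
  | tok t => simp [word, cost]
  | seq g g' ih ih' =>
    simp only [word, cost, List.length_append, Polynomial.eval_add]
    exact Nat.add_le_add (ih he) (ih' he)
  | loop i v g ih =>
    simp only [word, cost, List.length_flatMap, Polynomial.eval_add, Polynomial.eval_mul,
      Polynomial.eval_X, Polynomial.eval_ofNat]
    have h1 : ∀ x ∈ (List.range (e v)).map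
        (fun k => (g.word (Function.update e i k)).length), x ≤ g.cost.eval N := by
      intro x hx
      obtain ⟨k, hk, rfl⟩ := List.mem_map.1 hx
      exact ih (update_le he ((List.mem_range.1 hk).le.trans (he v)) i)
    have h2 := List.sum_le_card_nsmul _ _ h1
    simp only [List.length_map, List.length_range, smul_eq_mul] at h2
    have h3 := Nat.mul_le_mul_right (g.cost.eval N) (he v)
    nlinarith

open Cmd

/-- The command that copies the number on stack `val v` to stack `rem i`. -/
def copyCmd (i v : Var) : Cmd Stk :=
  -- Reading a stack destroys it, so the marks go to `tmp` and are restored while the copy is made.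
  (Cmd.loop (.val v) anyTok (move (.val v) .tmp)).seq
    (Cmd.loop .tmp anyTok ((move .tmp (.val v)).seq (push (.rem i) Tok.mark)))

theorem runs_copyCmd (i v : Var) (S : Stk → List Tok) (k : ℕ)
    (hv : S (.val v) = List.replicate k Tok.mark) (hi : S (.rem i) = []) (ht : S .tmp = []) :
    (copyCmd i v).Runs S (Function.update S (.rem i) (List.replicate k Tok.mark))
      (5 * k + 2) := by
  have h1 : (Cmd.loop (.val v) anyTok (move (.val v) .tmp)).Runs S
      (Function.update (Function.update S (.val v) []) .tmp (List.replicate k Tok.mark))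
      (2 * k + 1) := by
    have := runs_transfer (k := Stk.val v) (k' := .tmp) (by simp) (f := anyTok) (S := S)
      (l := List.replicate k Tok.mark) (r := []) (by simp [hv]) (by simp [anyTok]) (by simp)
    simpa [ht] using this
  have h2 : ∀ (m : ℕ) (S : Stk → List Tok), S .tmp = List.replicate m Tok.mark →
      (Cmd.loop .tmp anyTok ((move .tmp (.val v)).seq (push (.rem i) Tok.mark))).Runs S
        (Function.update (Function.update (Function.update S .tmp [])
          (.val v) (List.replicate m Tok.mark ++ S (.val v)))
          (.rem i) (List.replicate m Tok.mark ++ S (.rem i))) (3 * m + 1) := by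
    intro m
    induction m with
    | zero =>
      intro S hS
      have : Function.update S .tmp [] = S := by
        rw [Function.update_eq_self_iff, hS]; rfl
      simp only [List.replicate_zero, List.nil_append, this, Function.update_eq_self]
      exact runs_loop_done (by simp [hS])
    | succ m ih =>
      intro S hS
      have h1 := (runs_move (k := Stk.tmp) (k' := .val v) (S := S) hS (by simp)).seq
        (runs_push (.rem i) Tok.mark _)
      have h2 := h1.loop (k := .tmp) (f := anyTok) (by simp [hS, List.replicate_succ, anyTok])
        (ih _ (by simp))
      refine Eq.mp ?_ (h2.mono (t' := 3 * (m + 1) + 1) (by omega))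
      congr 1
      funext x
      by_cases hx : x = .rem i
      · simp [hx, List.replicate_succ']
      · by_cases hx' : x = .val v
        · simp [hx', List.replicate_succ']
        · by_cases hx'' : x = .tmp <;> simp [hx, hx', hx'']
  have h3 := h2 k (Function.update (Function.update S (.val v) []) .tmp
    (List.replicate k Tok.mark)) (by simp)
  refine Eq.mp ?_ ((h1.seq h3).mono (t' := 5 * k + 2) (by omega))
  congr 1
  funext x
  by_cases hx : x = .rem i
  · simp [hx, hi]
  · by_cases hx' : x = .val v
    · simp [hx', hv]
    · by_cases hx'' : x = .tmp <;> simp [hx, hx', hx'', ht]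

/-- The command that pushes the generated word on stack `acc`. -/
def cmd : Gen → Cmd Stk
  | tok t => push .acc t
  | seq g g' => g.cmd.seq g'.cmd
  | loop i v g =>
    (copyCmd i v).seq
      ((Cmd.loop (.rem i) anyTok ((pop (.rem i)).seq (g.cmd.seq (push (.val i) Tok.mark)))).seq
        (clear (.val i)))

/-- The stacks hold the values `e` of the variables; the variables outside `L` are not in use. -/
structure Ready (L : List Var) (e : Var → ℕ) (S : Stk → List Tok) : Prop where
  val : ∀ v, S (.val v) = List.replicate (e v) Tok.mark
  zero : ∀ v, v ∉ L → e v = 0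
  rem : ∀ v, v ∉ L → S (.rem v) = []
  tmp : S .tmp = []

theorem runs_cmd (g : Gen) {L : List Var} (hg : g.wf L = true) {e : Var → ℕ}
    {S : Stk → List Tok} (hS : Ready L e S) {N : ℕ} (he : ∀ v, e v ≤ N) :
    g.cmd.Runs S (Function.update S .acc ((g.word e).reverse ++ S .acc)) (g.cost.eval N) := by
  induction g generalizing L e S with
  | tok t => simpa [cmd, word, cost] using runs_push .acc t S
  | seq g g' ih ih' =>
    simp only [wf, Bool.and_eq_true] at hg
    have h1 := ih hg.1 hS he
    have h2 := ih' (S := Function.update S .acc ((g.word e).reverse ++ S .acc)) hg.2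
      ⟨by simpa using hS.val, hS.zero, by simpa using hS.rem, by simpa using hS.tmp⟩ he
    simp only [cost, Polynomial.eval_add]
    simpa [word, cmd] using h1.seq h2
  | loop i v g ih =>
    simp only [wf, Bool.and_eq_true, decide_eq_true_eq] at hg
    obtain ⟨hi, hv, hg⟩ := hg
    have hiv : v ≠ i := fun h => hi (h ▸ hv)
    have h1 := runs_copyCmd i v S (e v) (hS.val v) (hS.rem i hi) hS.tmp
    -- Loop invariant: `k` iterations are done and `r` remain; `val i` holds `k` marks and `rem i`
    -- holds `r`.
    have h2 : ∀ (r k : ℕ) (S : Stk → List Tok), k + r ≤ N →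
        Ready (i :: L) (Function.update e i k) S → S (.rem i) = List.replicate r Tok.mark →
        (Cmd.loop (.rem i) anyTok
          ((pop (.rem i)).seq (g.cmd.seq (push (.val i) Tok.mark)))).Runs S
          (Function.update (Function.update (Function.update S (.rem i) []) (.val i)
            (List.replicate (k + r) Tok.mark)) .acc
            (((List.range' k r).flatMap fun k => g.word (Function.update e i k)).reverse ++
              S .acc)) (r * (g.cost.eval N + 3) + 1) := by
      intro r
      induction r with
      | zero =>
        intro k S hk hR hr
        have e1 : Function.update S (.rem i) [] = S := by
          rw [Function.update_eq_self_iff, hr]; rfl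
        have e2 : Function.update S (.val i) (List.replicate k Tok.mark) = S := by
          rw [Function.update_eq_self_iff, hR.val]; simp
        simp only [add_zero, e1, e2, List.range'_zero, List.flatMap_nil, List.reverse_nil,
          List.nil_append, Function.update_eq_self]
        exact (runs_loop_done (by simp [hr])).mono (by omega)
      | succ r ihr =>
        intro k S hk hR hr
        have p1 := runs_pop (.rem i) S
        have p2 := ih (S := Function.update S (.rem i) (S (.rem i)).tail) hg
          ⟨by simpa using hR.val, hR.zero, ?_, by simpa using hR.tmp⟩
          (update_le he (by omega) i)
        · have p3 := p1.seq (p2.seq (runs_push (.val i) Tok.mark _))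
          have p4 := p3.loop (k := .rem i) (f := anyTok)
            (by simp [hr, List.replicate_succ, anyTok])
            (ihr (k + 1) _ (by omega) ⟨?_, ?_, ?_, ?_⟩ ?_)
          · refine Eq.mp ?_ (p4.mono
              (t' := (r + 1) * (g.cost.eval N + 3) + 1) (by linarith))
            congr 1
            funext x
            by_cases hx : x = .acc
            · simp [hx, List.range'_succ]
            · by_cases hx' : x = .val i
              · simp [hx', add_assoc, add_comm 1 r]
              · by_cases hx'' : x = .rem i <;> simp [hx, hx', hx'']
          · intro w
            by_cases hw : w = i
            · have := hR.val i
              simp only [Function.update_self] at this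
              simp [hw, this, List.replicate_succ]
            · have := hR.val w
              simp only [Function.update_of_ne hw] at this
              simp [hw, this]
          · intro w hw
            have h := hR.zero w hw
            have hwi : w ≠ i := fun h => hw (by simp [h])
            simpa [hwi] using h
          · intro w hw
            have hwi : w ≠ i := fun h => hw (by simp [h])
            simpa [hwi] using hR.rem w hw
          · simpa using hR.tmp
          · simp [hr]
        · intro w hw
          have hwi : w ≠ i := fun h => hw (by simp [h])
          simpa [hwi] using hR.rem w hw
    have h3 := h2 (e v) 0 (Function.update S (.rem i) (List.replicate (e v) Tok.mark))
      (by simpa using he v) ⟨?_, ?_, ?_, ?_⟩ (by simp)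
    · have h4 := h1.seq (h3.seq (runs_clear (.val i) _))
      refine Eq.mp ?_ (h4.mono (t' := (loop i v g).cost.eval N) ?_)
      · congr 1
        funext x
        by_cases hx : x = .acc
        · simp [hx, word, List.range_eq_range']
        · by_cases hx' : x = .val i
          -- Clearing `val i` restores the old value of `i`, which is 0 because `i ∉ L`.
          · simp [hx', hS.val, hS.zero i hi]
          · by_cases hx'' : x = .rem i <;>
              simp [hx, hx', hx'', hS.rem i hi]
      · simp only [cost, Polynomial.eval_add, Polynomial.eval_mul, Polynomial.eval_X,
          Polynomial.eval_ofNat]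
        simp
        have h5 := Nat.mul_le_mul_right (g.cost.eval N) (he v)
        have := he v
        nlinarith
    · intro w
      by_cases hw : w = i
      · simp [hw, hS.val, hS.zero i hi]
      · simp [hw, hS.val]
    · intro w hw
      simp only [List.mem_cons, not_or] at hw
      simpa [hw.1] using hS.zero w hw.2
    · intro w hw
      simp only [List.mem_cons, not_or] at hw
      simpa [hw.1] using hS.rem w hw.2
    · simpa using hS.tmp

end Gen

/-! ### A machine for words that depend on a number and a list of rationals -/

/-- The values of the variables outside of all loops. -/
def baseEnv (n k : ℕ) : Var → ℕ
  | .size => n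
  | .count => k
  | _ => 0

/-- The stacks outside of all loops. -/
def baseStk (n k : ℕ) (inp acc out : List Tok) : Stk → List Tok
  | .val v => List.replicate (baseEnv n k v) Tok.mark
  | .inp => inp
  | .acc => acc
  | .out => out
  | _ => []

theorem baseStk_ready (n k : ℕ) (inp acc out : List Tok) :
    Gen.Ready [.size, .count] (baseEnv n k) (baseStk n k inp acc out) where
  val _ := rfl
  zero v hv := by cases v <;> simp_all [baseEnv]
  rem _ _ := rfl
  tmp := rfl

theorem update_baseStk_acc (n k : ℕ) (inp acc out w : List Tok) :
    Function.update (baseStk n k inp acc out) .acc w = baseStk n k inp w out := by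
  funext x; cases x <;> rfl

theorem update_baseStk_inp (n k : ℕ) (inp acc out w : List Tok) :
    Function.update (baseStk n k inp acc out) .inp w = baseStk n k w acc out := by
  funext x; cases x <;> rfl

theorem update_baseStk_out (n k : ℕ) (inp acc out w : List Tok) :
    Function.update (baseStk n k inp acc out) .out w = baseStk n k inp acc w := by
  funext x; cases x <;> rfl

theorem update_baseStk_size (n k n' : ℕ) (inp acc out : List Tok) :
    Function.update (baseStk n k inp acc out) (.val .size) (List.replicate n' Tok.mark) =
      baseStk n' k inp acc out := by
  funext x
  cases x with
  | val v => cases v <;> rfl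
  | _ => rfl

theorem update_baseStk_count (n k k' : ℕ) (inp acc out : List Tok) :
    Function.update (baseStk n k inp acc out) (.val .count) (List.replicate k' Tok.mark) =
      baseStk n k' inp acc out := by
  funext x
  cases x with
  | val v => cases v <;> rfl
  | _ => rfl

open Cmd

theorem runs_gen (g : Gen) (hg : g.wf [.size, .count] = true) {n k N : ℕ} (hn : n ≤ N)
    (hk : k ≤ N) (inp acc out : List Tok) :
    g.cmd.Runs (baseStk n k inp acc out)
      (baseStk n k inp ((g.word (baseEnv n k)).reverse ++ acc) out) (g.cost.eval N) := by
  have := g.runs_cmd hg (baseStk_ready n k inp acc out) (N := N)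
    (fun v => by cases v <;> simp [baseEnv, hn, hk])
  rwa [update_baseStk_acc] at this

/-- Since `sep` occurs only at the end, a rational can be copied from the input without being
decoded. -/
theorem encRat_eq_append_sep (q : ℚ) :
    ∃ w : List Tok, encRat q = w ++ [Tok.sep] ∧ ∀ t ∈ w, decide (t ≠ Tok.sep) = true := by
  refine ⟨(if q.num < 0 then [Tok.minus] else []) ++
    (encBits q.num.natAbs ++ (Tok.slash :: encBits q.den)), by simp [encRat], ?_⟩
  intro t ht
  have hbits : ∀ m, t ∈ encBits m → t ≠ Tok.sep := by
    intro m hm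
    obtain ⟨b, -, rfl⟩ := List.mem_map.1 hm
    simp
  simp only [List.mem_append, List.mem_cons] at ht
  rw [decide_eq_true_eq]
  rcases ht with h | h | h | h
  · split_ifs at h <;> simp_all
  · exact hbits _ h
  · simp [h]
  · exact hbits _ h

/-- Generates a word and then copies a rational number from the input. -/
def copyRatCmd (B : Gen) : Cmd Stk :=
  B.cmd.seq ((loop .inp (fun t => decide (t ≠ Tok.sep)) (move .inp .acc)).seq
    ((move .inp .acc).seq (push (.val .count) Tok.mark)))

theorem runs_copyRatCmd (B : Gen) (hB : B.wf [.size, .count] = true) {n k N : ℕ} (hn : n ≤ N)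
    (hk : k ≤ N) (q : ℚ) (hq : (encRat q).length ≤ N) (inp acc out : List Tok) :
    (copyRatCmd B).Runs (baseStk n k (encRat q ++ inp) acc out)
      (baseStk n (k + 1) inp ((B.word (baseEnv n k) ++ encRat q).reverse ++ acc) out)
      (B.cost.eval N + 2 * N + 3) := by
  obtain ⟨w, hw, hsep⟩ := encRat_eq_append_sep q
  rw [hw] at hq ⊢
  have h1 := runs_gen B hB hn hk (w ++ [Tok.sep] ++ inp) acc out
  have h2 := runs_transfer (k := Stk.inp) (k' := .acc) (by simp)
    (f := fun t => decide (t ≠ Tok.sep))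
    (S := baseStk n k (w ++ [Tok.sep] ++ inp) ((B.word (baseEnv n k)).reverse ++ acc) out)
    (l := w) (r := Tok.sep :: inp) (by simp [baseStk]) hsep (by simp)
  rw [update_baseStk_inp, update_baseStk_acc] at h2
  have h3 := runs_move (k := Stk.inp) (k' := .acc)
    (S := baseStk n k (Tok.sep :: inp) (w.reverse ++ ((B.word (baseEnv n k)).reverse ++ acc)) out)
    (t := Tok.sep) (l := inp) rfl (by simp)
  rw [update_baseStk_inp, update_baseStk_acc] at h3
  have h4 := runs_push (.val .count) Tok.mark (baseStk n k inp
    (Tok.sep :: (w.reverse ++ ((B.word (baseEnv n k)).reverse ++ acc))) out)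
  have h5 : Tok.mark :: baseStk n k inp (Tok.sep :: (w.reverse ++
      ((B.word (baseEnv n k)).reverse ++ acc))) out (.val .count) =
      List.replicate (k + 1) Tok.mark := rfl
  rw [h5, update_baseStk_count] at h4
  have h6 := (h1.seq (h2.seq (h3.seq h4))).mono (t' := B.cost.eval N + 2 * N + 3) (by
    simp at hq; omega)
  simpa [copyRatCmd] using h6

/-- The word generated while the rationals in `l` are read, the first of which has number `k`. -/
def ratsWord (B : Gen) (n k : ℕ) (l : List ℚ) : List Tok :=
  (l.zipIdx k).flatMap fun a => B.word (baseEnv n a.2) ++ encRat a.1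

theorem runs_copyRats (B : Gen) (hB : B.wf [.size, .count] = true) {n N : ℕ} (hn : n ≤ N)
    (out : List Tok) (l : List ℚ) : ∀ (k : ℕ) (acc : List Tok), k + l.length ≤ N →
      (∀ q ∈ l, (encRat q).length ≤ N) →
      (loop .inp anyTok (copyRatCmd B)).Runs (baseStk n k (l.flatMap encRat) acc out)
        (baseStk n (k + l.length) [] ((ratsWord B n k l).reverse ++ acc) out)
        (l.length * (B.cost.eval N + 2 * N + 4) + 1) := by
  induction l with
  | nil =>
    intro k acc _ _
    exact (runs_loop_done (by simp [baseStk])).mono (by omega)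
  | cons q l ih =>
    intro k acc hk hl
    simp only [List.length_cons] at hk
    have h1 := runs_copyRatCmd B hB hn (k := k) (by omega) q (hl q (by simp)) (l.flatMap encRat)
      acc out
    have h2 := h1.loop (k := .inp) (f := anyTok) ?_
      (ih (k + 1) _ (by omega) fun q hq => hl q (by simp [hq]))
    · have h3 := h2.mono (t' := (q :: l).length * (B.cost.eval N + 2 * N + 4) + 1) (by
        simp only [List.length_cons]; linarith)
      simpa [ratsWord, add_assoc, add_comm 1 l.length] using h3
    · obtain ⟨w, hw, -⟩ := encRat_eq_append_sep q
      rw [hw]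
      cases w <;> simp [baseStk, anyTok]

/-- The program that reads a number and a list of rationals and writes the word generated by `A`,
the word generated by `B` with each of the rationals, and the word generated by `C`. -/
def tableCmd (A B C : Gen) : Cmd Stk :=
  (loop .inp (fun t => decide (t = Tok.mark)) (move .inp (.val .size))).seq
    ((pop .inp).seq (A.cmd.seq ((loop .inp anyTok (copyRatCmd B)).seq
      ((clear (.val .count)).seq (C.cmd.seq ((clear (.val .size)).seq
        -- `acc` holds the word reversed; this transfer reverses it again.
        (loop .acc anyTok (move .acc .out))))))))

def tableWord (A B C : Gen) (n : ℕ) (l : List ℚ) : List Tok :=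
  A.word (baseEnv n 0) ++ (ratsWord B n 0 l ++ C.word (baseEnv n 0))

/-- A bound for the length of the word. -/
noncomputable def tableLength (A B C : Gen) : Polynomial ℕ :=
  A.cost + (Polynomial.X * (B.cost + Polynomial.X) + C.cost)

theorem length_tableWord_le (A B C : Gen) {n N : ℕ} {l : List ℚ} (hn : n ≤ N)
    (hl : l.length ≤ N) (hq : ∀ q ∈ l, (encRat q).length ≤ N) :
    (tableWord A B C n l).length ≤ (tableLength A B C).eval N := by
  have henv : ∀ k ≤ N, ∀ v, baseEnv n k v ≤ N := by
    intro k hk v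
    cases v <;> simp [baseEnv, hn, hk]
  have hrats : ∀ (l : List ℚ) (k : ℕ), k + l.length ≤ N → (∀ q ∈ l, (encRat q).length ≤ N) →
      (ratsWord B n k l).length ≤ l.length * (B.cost.eval N + N) := by
    intro l
    induction l with
    | nil => intro k _ _; simp [ratsWord]
    | cons q l ih =>
      intro k hk hq
      simp only [List.length_cons] at hk
      have h1 := ih (k + 1) (by omega) fun q h => hq q (by simp [h])
      have h2 := hq q (by simp)
      have h3 := B.length_word_le (henv k (by omega))
      simp only [ratsWord] at h1
      simp only [ratsWord, List.zipIdx_cons, List.flatMap_cons, List.length_append,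
        List.length_cons]
      linarith
  have h1 := A.length_word_le (henv 0 (by omega))
  have h2 := C.length_word_le (henv 0 (by omega))
  have h3 := hrats l 0 (by omega) hq
  have h4 := Nat.mul_le_mul_right (B.cost.eval N + N) hl
  simp only [tableWord, tableLength, List.length_append, Polynomial.eval_add, Polynomial.eval_mul,
    Polynomial.eval_X]
  omega

/-- A bound for the running time. -/
noncomputable def tableTime (A B C : Gen) : Polynomial ℕ :=
  2 * tableLength A B C + A.cost + C.cost + Polynomial.X * (B.cost + 2 * Polynomial.X + 10) + 10

theorem runs_tableCmd {A B C : Gen} (hA : A.wf [.size, .count] = true)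
    (hB : B.wf [.size, .count] = true) (hC : C.wf [.size, .count] = true) {n N : ℕ} {l : List ℚ}
    (hn : n ≤ N) (hl : l.length ≤ N) (hq : ∀ q ∈ l, (encRat q).length ≤ N) :
    (tableCmd A B C).Runs (fun k => if k = .inp then encUnary n ++ l.flatMap encRat else [])
      (fun k => if k = .out then tableWord A B C n l else []) ((tableTime A B C).eval N) := by
  have e1 : (fun k => if k = Stk.inp then encUnary n ++ l.flatMap encRat else []) =
      baseStk 0 0 (encUnary n ++ l.flatMap encRat) [] [] := by
    funext x
    cases x with
    | val v => cases v <;> rfl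
    | _ => rfl
  have e2 : (fun k => if k = Stk.out then tableWord A B C n l else []) =
      baseStk 0 0 [] [] (tableWord A B C n l) := by
    funext x
    cases x with
    | val v => cases v <;> rfl
    | _ => rfl
  rw [e1, e2]
  have h1 := runs_transfer (k := Stk.inp) (k' := .val .size) (by simp)
    (f := fun t => decide (t = Tok.mark))
    (S := baseStk 0 0 (encUnary n ++ l.flatMap encRat) [] [])
    (l := List.replicate n Tok.mark) (r := Tok.sep :: l.flatMap encRat)
    (by simp [baseStk, encUnary]) (by simp) (by simp)
  have e3 : (List.replicate n Tok.mark).reverse ++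
      baseStk 0 0 (encUnary n ++ l.flatMap encRat) [] [] (.val .size) =
      List.replicate n Tok.mark := by simp [baseStk, baseEnv]
  rw [update_baseStk_inp, e3, update_baseStk_size] at h1
  have h2 := runs_pop .inp (baseStk n 0 (Tok.sep :: l.flatMap encRat) [] [])
  rw [update_baseStk_inp] at h2
  have h3 := runs_gen A hA hn (Nat.zero_le N) (l.flatMap encRat) [] []
  have h4 := runs_copyRats B hB hn [] l 0 ((A.word (baseEnv n 0)).reverse ++ []) (by omega) hq
  have h5 := runs_clear (.val .count) (baseStk n (0 + l.length) []
    ((ratsWord B n 0 l).reverse ++ ((A.word (baseEnv n 0)).reverse ++ [])) [])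
  have e4 := update_baseStk_count n (0 + l.length) 0 []
    ((ratsWord B n 0 l).reverse ++ ((A.word (baseEnv n 0)).reverse ++ [])) []
  rw [List.replicate_zero] at e4
  rw [e4] at h5
  have h6 := runs_gen C hC hn (Nat.zero_le N) []
    ((ratsWord B n 0 l).reverse ++ ((A.word (baseEnv n 0)).reverse ++ [])) []
  have e5 : (C.word (baseEnv n 0)).reverse ++
      ((ratsWord B n 0 l).reverse ++ ((A.word (baseEnv n 0)).reverse ++ [])) =
      (tableWord A B C n l).reverse := by simp [tableWord]
  rw [e5] at h6
  have h7 := runs_clear (.val .size) (baseStk n 0 [] (tableWord A B C n l).reverse [])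
  have e6 := update_baseStk_size n 0 0 [] (tableWord A B C n l).reverse []
  rw [List.replicate_zero] at e6
  rw [e6] at h7
  have h8 := runs_transfer (k := Stk.acc) (k' := .out) (by simp) (f := anyTok)
    (S := baseStk 0 0 [] (tableWord A B C n l).reverse [])
    (l := (tableWord A B C n l).reverse) (r := []) (by simp [baseStk]) (by simp [anyTok]) (by simp)
  rw [update_baseStk_acc, update_baseStk_out] at h8
  have e7 : (tableWord A B C n l).reverse.reverse ++
      baseStk 0 0 [] (tableWord A B C n l).reverse [] .out = tableWord A B C n l := by
    simp [baseStk]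
  rw [e7] at h8
  refine (h1.seq (h2.seq (h3.seq (h4.seq (h5.seq (h6.seq (h7.seq h8))))))).mono ?_
  have h9 := length_tableWord_le A B C hn hl hq
  have h10 := Nat.mul_le_mul_right (B.cost.eval N + 2 * N + 4) hl
  simp only [List.length_replicate, List.length_reverse, baseStk, baseEnv, zero_add, tableTime,
    Polynomial.eval_add, Polynomial.eval_mul, Polynomial.eval_X, Polynomial.eval_ofNat]
  nlinarith

/-- The input length bounds the size, the number of rationals and the length of each of their
encodings, so it can serve as the single parameter `N` of all earlier estimates. -/
theorem computable_of_tableWord {α β : Type} {A B C : Gen} (hA : A.wf [.size, .count] = true)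
    (hB : B.wf [.size, .count] = true) (hC : C.wf [.size, .count] = true)
    {ea : α → List Tok} {eb : β → List Tok} {g : α → β} (size : α → ℕ) (rats : α → List ℚ)
    (hea : ∀ a, ea a = encUnary (size a) ++ (rats a).flatMap encRat)
    (heb : ∀ a, eb (g a) = tableWord A B C (size a) (rats a)) :
    Nonempty (TM2ComputableInPolyTime ea eb g) ∧
      ∀ a, (eb (g a)).length ≤ (tableLength A B C).eval (ea a).length := by
  have hn : ∀ a, size a ≤ (ea a).length := by
    intro a
    simp [hea, encUnary]
  have hq : ∀ a, ∀ q ∈ rats a, (encRat q).length ≤ (ea a).length := by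
    intro a q hq
    have := (List.sublist_flatten_of_mem (List.mem_map_of_mem (f := encRat) hq)).length_le
    rw [hea, List.length_append, List.flatMap_def]
    omega
  have hl : ∀ a, (rats a).length ≤ (ea a).length := by
    intro a
    have : ∀ l : List ℚ, l.length ≤ (l.flatMap encRat).length := by
      intro l
      induction l with
      | nil => simp
      | cons q l ih =>
        obtain ⟨w, hw, -⟩ := encRat_eq_append_sep q
        simp only [List.length_cons, List.flatMap_cons, hw, List.length_append]
        omega
    have := this (rats a)
    rw [hea, List.length_append]
    omega
  refine ⟨⟨{ tm := (tableCmd A B C).machine .inp .out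
             inputAlphabet := Equiv.refl Tok
             outputAlphabet := Equiv.refl Tok
             time := tableTime A B C + 1
             outputsFun := fun a => Classical.choice ?_ }⟩, fun a => ?_⟩
  · have h := machine_outputs (runs_tableCmd hA hB hC (hn a) (hl a) (hq a))
    rw [← hea, ← heb] at h
    simp only [Polynomial.eval_add, Polynomial.eval_one]
    have e : ∀ l : List Tok, l = List.map (Equiv.refl Tok).invFun l := fun l => (List.map_id l).symm
    rw [e (ea a), e (eb (g a))] at h
    simp only [List.length_map] at h
    exact h
  · rw [heb]
    exact length_tableWord_le A B C (hn a) (hl a) (hq a)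

/-! ### The fixed point map -/

section Map

variable {n : ℕ}

/-- The weight given to the affordable mixture of a good `b` with price below `1` and a
good `c`: it is positive if the mixture is better than the bundle `y`, or if `y` is too expensive.
-/
noncomputable def mixWeight (p u y : Fin n → ℝ) (b c : Fin n) : ℝ :=
  -- Truncations replace the case distinctions on `p b < 1` and `p c > 1`, which keeps the map
  -- continuous and free of branching.
  max (1 - p b) 0 *
    (max (max (1 - p b) 0 * (u c - ∑ j, u j * y j) + max (p c - 1) 0 * (u b - ∑ j, u j * y j)) 0 +
      max (∑ j, p j * y j - 1) 0)

/-- The bundle `y` plus all weighted mixtures, before normalization. -/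
noncomputable def mixBundle (p u y : Fin n → ℝ) (j : Fin n) : ℝ :=
  y j + ∑ b, ∑ c, ((if c = j then mixWeight p u y b c * max (1 - p b) 0 else 0) +
    (if b = j then mixWeight p u y b c * max (p c - 1) 0 else 0))

/-- The total size of `mixBundle`. -/
noncomputable def mixSize (p u y : Fin n → ℝ) : ℝ :=
  1 + ∑ b, ∑ c, (mixWeight p u y b c * max (1 - p b) 0 + mixWeight p u y b c * max (p c - 1) 0)

/-- The price of a good after adjustment to its excess demand, before all prices are shifted. -/
noncomputable def adjustedPrice (p : Fin n → ℝ) (x : Fin n → Fin n → ℝ) (j : Fin n) : ℝ :=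
  min (max (p j - 1 + ∑ i, x i j) 0) n

/-! ### Linear identities for the mixture step -/

theorem mixWeight_nonneg (p u y : Fin n → ℝ) (b c : Fin n) : 0 ≤ mixWeight p u y b c := by
  unfold mixWeight
  positivity

/-- All added mixtures are nonnegative, whatever `p`, `u` and `y` are. Normalization therefore never
divides by zero, even outside the domain. -/
theorem one_le_mixSize (p u y : Fin n → ℝ) : 1 ≤ mixSize p u y := by
  have : 0 ≤ ∑ b, ∑ c, (mixWeight p u y b c * max (1 - p b) 0 +
      mixWeight p u y b c * max (p c - 1) 0) :=
    Finset.sum_nonneg fun b _ => Finset.sum_nonneg fun c _ => add_nonneg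
      (mul_nonneg (mixWeight_nonneg ..) (le_max_right _ _))
      (mul_nonneg (mixWeight_nonneg ..) (le_max_right _ _))
  unfold mixSize
  linarith

theorem mixBundle_nonneg {p u y : Fin n → ℝ} (hy : ∀ j, 0 ≤ y j) (j : Fin n) :
    0 ≤ mixBundle p u y j := by
  refine add_nonneg (hy j) (Finset.sum_nonneg fun b _ => Finset.sum_nonneg fun c _ => ?_)
  have h1 := mul_nonneg (mixWeight_nonneg p u y b c) (le_max_right (1 - p b) 0)
  have h2 := mul_nonneg (mixWeight_nonneg p u y b c) (le_max_right (p c - 1) 0)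
  split_ifs <;> linarith

/-- Exchanging the sums collapses the indicators. The functional `q = 1` gives the size, `q = p` the
cost and `q = u` the utility. -/
theorem sum_mul_mixBundle (p u y q : Fin n → ℝ) :
    ∑ j, q j * mixBundle p u y j = ∑ j, q j * y j +
      ∑ b, ∑ c, (mixWeight p u y b c * max (1 - p b) 0 * q c +
        mixWeight p u y b c * max (p c - 1) 0 * q b) := by
  simp only [mixBundle, mul_add, Finset.sum_add_distrib, Finset.mul_sum]
  congr 1
  congr 1
  · rw [Finset.sum_comm]
    refine Finset.sum_congr rfl fun b _ => ?_
    rw [Finset.sum_comm]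
    refine Finset.sum_congr rfl fun c _ => ?_
    simp [mul_comm]
  · rw [Finset.sum_comm]
    refine Finset.sum_congr rfl fun b _ => ?_
    rw [Finset.sum_comm]
    refine Finset.sum_congr rfl fun c _ => ?_
    simp [mul_comm]

theorem sum_mixBundle {p u y : Fin n → ℝ} (hy : ∑ j, y j = 1) :
    ∑ j, mixBundle p u y j = mixSize p u y := by
  have := sum_mul_mixBundle p u y (fun _ => 1)
  simp only [one_mul, mul_one, hy] at this
  exact this

/-- Apply the functional `q` to the fixed point equation and cancel the contribution of `y` itself:
on weighted average, the mixtures have the same `q`-value per unit as `y`. -/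
theorem sum_mixWeight_mul_eq_zero {p u y : Fin n → ℝ}
    (hfix : ∀ j, mixBundle p u y j = mixSize p u y * y j) (q : Fin n → ℝ) :
    ∑ b, ∑ c, mixWeight p u y b c * (max (1 - p b) 0 * (q c - ∑ j, q j * y j) +
      max (p c - 1) 0 * (q b - ∑ j, q j * y j)) = 0 := by
  have h1 := sum_mul_mixBundle p u y q
  have h2 : ∑ j, q j * mixBundle p u y j = mixSize p u y * ∑ j, q j * y j := by
    rw [Finset.mul_sum]
    exact Finset.sum_congr rfl fun j _ => by rw [hfix j]; ring
  have h3 : ∑ b, ∑ c, mixWeight p u y b c * (max (1 - p b) 0 * (q c - ∑ j, q j * y j) +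
      max (p c - 1) 0 * (q b - ∑ j, q j * y j)) =
      ∑ b, ∑ c, (mixWeight p u y b c * max (1 - p b) 0 * q c +
        mixWeight p u y b c * max (p c - 1) 0 * q b) -
      (∑ b, ∑ c, (mixWeight p u y b c * max (1 - p b) 0 +
        mixWeight p u y b c * max (p c - 1) 0)) * ∑ j, q j * y j := by
    simp only [Finset.sum_mul, ← Finset.sum_sub_distrib]
    exact Finset.sum_congr rfl fun b _ => Finset.sum_congr rfl fun c _ => by ring
  rw [h3]
  rw [h2] at h1
  unfold mixSize at h1
  linarith

/-! ### Fixed points are equilibria -/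

/-- If the bundle `y` is unchanged, it is affordable. -/
theorem cost_le_one_of_fixed {p u y : Fin n → ℝ} {a : Fin n} (ha : p a = 0)
    (hfix : ∀ j, mixBundle p u y j = mixSize p u y * y j) : ∑ j, p j * y j ≤ 1 := by
  by_contra! hlt
  have h0 := sum_mixWeight_mul_eq_zero hfix p
  -- Mixtures are affordable: for `p b ≤ 1 ≤ p c`, size and cost are both `p c - p b ≥ 1 - p b`, and
  -- this size multiplies the negative number `1 - ∑ j, p j * y j`. For `p c ≤ 1` only good `c`
  -- remains; for `p b ≥ 1` the weight vanishes.
  have hterm : ∀ b c, mixWeight p u y b c * (max (1 - p b) 0 * (p c - ∑ j, p j * y j) +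
      max (p c - 1) 0 * (p b - ∑ j, p j * y j)) ≤
      mixWeight p u y b c * (max (1 - p b) 0 * (1 - ∑ j, p j * y j)) := by
    intro b c
    rcases le_total 1 (p b) with hb | hb
    · simp [mixWeight, max_eq_right (sub_nonpos.2 hb)]
    · refine mul_le_mul_of_nonneg_left ?_ (mixWeight_nonneg ..)
      rw [max_eq_left (sub_nonneg.2 hb)]
      rcases le_total 1 (p c) with hc | hc
      · rw [max_eq_left (sub_nonneg.2 hc)]
        nlinarith
      · rw [max_eq_right (sub_nonpos.2 hc)]
        nlinarith
  have hnonpos : ∀ b c, mixWeight p u y b c * (max (1 - p b) 0 * (p c - ∑ j, p j * y j) +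
      max (p c - 1) 0 * (p b - ∑ j, p j * y j)) ≤ 0 := fun b c =>
    (hterm b c).trans (mul_nonpos_of_nonneg_of_nonpos (mixWeight_nonneg ..)
      (mul_nonpos_of_nonneg_of_nonpos (le_max_right _ _) (by linarith)))
  -- The pair `(a, a)`, that is the free good alone, contradicts the vanishing sum: its weight is at
  -- least the positive excess cost, so its term is strictly negative.
  have h1 := (Finset.sum_eq_zero_iff_of_nonpos fun b _ =>
    Finset.sum_nonpos fun c _ => hnonpos b c).1 h0 a (Finset.mem_univ a)
  have h2 := (Finset.sum_eq_zero_iff_of_nonpos fun c _ => hnonpos a c).1 h1 a (Finset.mem_univ a)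
  have h3 := hterm a a
  rw [h2] at h3
  have hw : 0 < mixWeight p u y a a := by
    unfold mixWeight
    have : 0 < max (∑ j, p j * y j - 1) 0 := lt_max_of_lt_left (by linarith)
    have h : max (1 - p a) 0 = 1 := by simp [ha]
    rw [h]
    positivity
  have h : max (1 - p a) 0 = 1 := by simp [ha]
  rw [h] at h3
  nlinarith

/-- If the bundle `y` is unchanged, it is optimal. -/
theorem optimal_of_fixed {p u y : Fin n → ℝ} {a : Fin n} (ha : p a = 0)
    (hfix : ∀ j, mixBundle p u y j = mixSize p u y * y j) {z : Fin n → ℝ} (hz : ∀ j, 0 ≤ z j)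
    (hz1 : ∑ j, z j = 1) (hpz : ∑ j, p j * z j ≤ 1) : ∑ j, u j * z j ≤ ∑ j, u j * y j := by
  have hcost := cost_le_one_of_fixed ha hfix
  have h0 := sum_mixWeight_mul_eq_zero hfix u
  set U := ∑ j, u j * y j with hU
  have hE : max (∑ j, p j * y j - 1) 0 = 0 := max_eq_right (by linarith)
  -- Without excess cost the weight is `s` times the positive part of the gain, and the positive
  -- part times the gain is the square of the positive part.
  have hterm : ∀ b c, mixWeight p u y b c * (max (1 - p b) 0 * (u c - U) +
      max (p c - 1) 0 * (u b - U)) = max (1 - p b) 0 *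
        max (max (1 - p b) 0 * (u c - U) + max (p c - 1) 0 * (u b - U)) 0 ^ 2 := by
    intro b c
    rw [mixWeight, hE, add_zero, ← hU]
    rcases le_total 0 (max (1 - p b) 0 * (u c - U) + max (p c - 1) 0 * (u b - U)) with h | h
    · rw [max_eq_left h]; ring
    · rw [max_eq_right h]; ring
  simp only [hterm] at h0
  have hgain : ∀ b c, p b < 1 → (1 - p b) * (u c - U) + max (p c - 1) 0 * (u b - U) ≤ 0 := by
    intro b c hb
    have hnn : ∀ b c, 0 ≤ max (1 - p b) 0 *
        max (max (1 - p b) 0 * (u c - U) + max (p c - 1) 0 * (u b - U)) 0 ^ 2 :=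
      fun b c => by positivity
    have h1 := (Finset.sum_eq_zero_iff_of_nonneg fun b _ =>
      Finset.sum_nonneg fun c _ => hnn b c).1 h0 b (Finset.mem_univ b)
    have h2 := (Finset.sum_eq_zero_iff_of_nonneg fun c _ => hnn b c).1 h1 c (Finset.mem_univ c)
    have hs : max (1 - p b) 0 = 1 - p b := max_eq_left (by linarith)
    rw [hs] at h2
    have h3 := (mul_eq_zero.1 h2).resolve_left (by linarith)
    exact max_eq_right_iff.1 (pow_eq_zero_iff (by norm_num) |>.1 h3)
  -- The least loss of utility per dollar saved below price 1 will be the dual multiplier `r` of the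
  -- budget constraint; the free good `a` makes the set nonempty.
  obtain ⟨b, hb, hmin⟩ := Finset.exists_min_image (Finset.univ.filter fun b => p b < 1)
    (fun b => (U - u b) / (1 - p b)) ⟨a, by simp [ha]⟩
  simp only [Finset.mem_filter, Finset.mem_univ, true_and] at hb hmin
  have hle : ∀ b, p b < 1 → u b ≤ U := by
    intro b hb
    have := hgain b b hb
    rw [max_eq_right (by linarith)] at this
    nlinarith
  obtain ⟨r, hr⟩ : ∃ r, r = (U - u b) / (1 - p b) := ⟨_, rfl⟩
  have hr0 : 0 ≤ r := hr ▸ div_nonneg (by linarith [hle b hb]) (by linarith)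
  have hrb : r * (1 - p b) = U - u b := by
    rw [hr]
    field_simp [show (1 - p b) ≠ 0 by linarith]
  -- Dual feasibility. Goods with price below 1 satisfy it by minimality of `r`; the others because
  -- mixing them with the minimizer `b` brings no gain.
  have hbound : ∀ c, u c - U ≤ -r * (1 - p c) := by
    intro c
    rcases lt_or_ge (p c) 1 with hc | hc
    · have h1 := hmin c hc
      rw [← hr, le_div_iff₀ (by linarith)] at h1
      linarith
    · have h1 := hgain b c hb
      rw [max_eq_left (by linarith)] at h1
      have h2 : u b - U = -(r * (1 - p b)) := by linarith
      rw [h2] at h1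
      have h3 : (1 - p b) * ((u c - U) - r * (p c - 1)) ≤ 0 := by linarith
      have h4 : (u c - U) - r * (p c - 1) ≤ 0 := by
        by_contra! h
        nlinarith
      linarith
  have h1 : ∑ j, (u j - U) * z j ≤ ∑ j, (-r * (1 - p j)) * z j :=
    Finset.sum_le_sum fun j _ => mul_le_mul_of_nonneg_right (hbound j) (hz j)
  have h2 : ∑ j, (u j - U) * z j = ∑ j, u j * z j - U := by
    simp only [sub_mul, Finset.sum_sub_distrib, ← Finset.mul_sum, hz1, mul_one]
  have h3 : ∑ j, (-r * (1 - p j)) * z j = -r * (1 - ∑ j, p j * z j) := by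
    simp only [mul_assoc, ← Finset.mul_sum, sub_mul, Finset.sum_sub_distrib, one_mul, hz1]
  rw [h2, h3] at h1
  nlinarith

/-- Prices and allocations unchanged by the map are an equilibrium. -/
theorem isHZEquilibrium_of_fixed {u : Fin n → Fin n → ℝ} {p : Fin n → ℝ} {x : Fin n → Fin n → ℝ}
    {t : ℝ} (hp : ∀ j, 0 ≤ p j) (hx : ∀ i j, 0 ≤ x i j) (hx1 : ∀ i, ∑ j, x i j = 1)
    (ht : 0 ≤ t) (htle : ∀ j, t ≤ adjustedPrice p x j)
    (hteq : t = n ∨ ∃ j, t = adjustedPrice p x j) (hpfix : ∀ j, p j = adjustedPrice p x j - t)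
    (hfix : ∀ i j, mixBundle p (u i) (x i) j = mixSize p (u i) (x i) * x i j) :
    IsHZEquilibrium u p x := by
  have htotal : ∑ j, (∑ i, x i j - 1) = 0 := by
    rw [Finset.sum_sub_distrib, Finset.sum_comm]
    simp [hx1]
  rcases Nat.eq_zero_or_pos n with rfl | hn
  · exact ⟨hx, fun j => j.elim0, hx1, hp, fun i => i.elim0, fun i => i.elim0⟩
  have hn' : (0 : ℝ) < n := by exact_mod_cast hn
  -- If `t > 0`, no adjusted price was truncated at 0, so `p j + t ≤ p j - 1 + ∑ i, x i j` for all
  -- `j`; summing over `j` contradicts `htotal`.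
  have ht0 : t = 0 := by
    by_contra hne
    have htpos : 0 < t := lt_of_le_of_ne ht (Ne.symm hne)
    have h1 : ∀ j, t ≤ ∑ i, x i j - 1 := by
      intro j
      have h2 := htle j
      have h3 := hpfix j
      have h4 : adjustedPrice p x j ≤ p j - 1 + ∑ i, x i j := by
        unfold adjustedPrice at h2 ⊢
        have h5 : 0 < max (p j - 1 + ∑ i, x i j) 0 :=
          htpos.trans_le (h2.trans (min_le_left _ _))
        rcases lt_max_iff.1 h5 with h6 | h6
        · rw [max_eq_left h6.le]; exact min_le_left _ _
        · exact absurd h6 (lt_irrefl _)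
      linarith
    have h2 := Finset.sum_le_sum fun j (_ : j ∈ Finset.univ) => h1 j
    rw [htotal] at h2
    simp only [Finset.sum_const, Finset.card_univ, Fintype.card_fin, nsmul_eq_mul] at h2
    nlinarith
  obtain ⟨a, ha⟩ : ∃ a, p a = 0 := by
    rcases hteq with h | ⟨j, hj⟩
    · exact absurd (ht0 ▸ h) hn'.ne
    · exact ⟨j, by rw [hpfix j, ← hj, sub_self]⟩
  have hcost : ∀ i, ∑ j, p j * x i j ≤ 1 := fun i => cost_le_one_of_fixed ha (hfix i)
  -- The price of a good in excess demand can stay fixed only at the cap `n`. Spending on it is then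
  -- `n * ∑ i, x i j > n`, more than all budgets together.
  have hle : ∀ j, ∑ i, x i j - 1 ≤ 0 := by
    intro j
    by_contra! hlt
    have h1 : p j = n := by
      have h2 := hpfix j
      rw [ht0, sub_zero, adjustedPrice] at h2
      have h3 := hp j
      rw [max_eq_left (by linarith)] at h2
      rcases min_choice (p j - 1 + ∑ i, x i j) (n : ℝ) with h4 | h4
      · rw [h4] at h2; linarith
      · rw [h4] at h2; exact h2
    have h2 : ∑ i, p j * x i j ≤ ∑ i : Fin n, (1 : ℝ) := by
      refine Finset.sum_le_sum fun i _ => le_trans ?_ (hcost i)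
      exact Finset.single_le_sum (f := fun j => p j * x i j)
        (fun k _ => mul_nonneg (hp k) (hx i k)) (Finset.mem_univ j)
    rw [← Finset.mul_sum, h1] at h2
    simp only [Finset.sum_const, Finset.card_univ, Fintype.card_fin, nsmul_eq_mul] at h2
    nlinarith
  refine ⟨hx, fun j => ?_, hx1, hp, hcost, fun i z hz hz1 hpz =>
    optimal_of_fixed ha (hfix i) hz hz1 hpz⟩
  have := (Finset.sum_eq_zero_iff_of_nonpos fun j _ => hle j).1 htotal j (Finset.mem_univ j)
  linarith

end Map

/-! ### Programs on named registers -/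

/-- Named registers: prices, allocation, utilities, adjusted prices, the bundle under construction,
and temporary values. -/
inductive Reg (n : ℕ) : Type
  | P (j : Fin n)
  | X (i j : Fin n)
  | U (i j : Fin n)
  | Q (j : Fin n)
  | A (j : Fin n)
  | T (k : ℕ)
  deriving DecidableEq

variable {n : ℕ}

/-- The number of a named register. -/
def Reg.addr : Reg n → ℕ
  -- Prices and shares occupy the first `n + n * n` registers, the input and output vector. The
  -- utilities follow row by row, so that the `k`-th utility read goes to register `n + n * n + k`.
  | P j => j
  | X i j => n + (i * n + j)
  | U i j => n + n * n + (i * n + j)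
  | Q j => n + n * n + n * n + j
  | A j => n + n * n + n * n + n + j
  | T k => n + n * n + n * n + n + n + k

theorem mul_add_lt_mul (i j : Fin n) : (i : ℕ) * n + j < n * n := by
  have h1 : ((i : ℕ) + 1) * n ≤ n * n := Nat.mul_le_mul_right n i.isLt
  have h2 := j.isLt
  nlinarith

theorem eq_of_mul_add_eq {i j i' j' : Fin n} (h : (i : ℕ) * n + j = i' * n + j') :
    i = i' ∧ j = j' := by
  have : finProdFinEquiv (i, j) = finProdFinEquiv (i', j') := by
    apply Fin.ext
    simp only [finProdFinEquiv_apply_val]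
    linarith
  simpa using finProdFinEquiv.injective this

/-- The blocks are disjoint because `i * n + j < n * n`. Injectivity makes an assignment to one
named register leave all others unchanged. -/
theorem Reg.addr_injective : Function.Injective (Reg.addr (n := n)) := by
  intro r r' h
  have hb := fun i j : Fin n => mul_add_lt_mul i j
  cases r <;> cases r' <;> simp only [addr] at h
  case P.P j j' => rw [Fin.ext h]
  case X.X i j i' j' =>
    obtain ⟨rfl, rfl⟩ := eq_of_mul_add_eq (Nat.add_left_cancel h); rfl
  case U.U i j i' j' =>
    obtain ⟨rfl, rfl⟩ := eq_of_mul_add_eq (Nat.add_left_cancel h); rfl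
  case Q.Q j j' => rw [Fin.ext (Nat.add_left_cancel h)]
  case A.A j j' => rw [Fin.ext (Nat.add_left_cancel h)]
  case T.T k k' => rw [Nat.add_left_cancel h]
  all_goals exfalso
  case P.X j i j' => omega
  case P.U j i j' => omega
  case P.Q j j' => omega
  case P.A j j' => omega
  case P.T j k => omega
  case X.P i j j' => omega
  case X.U i j i' j' => have := hb i j; omega
  case X.Q i j j' => have := hb i j; omega
  case X.A i j j' => have := hb i j; omega
  case X.T i j k => have := hb i j; omega
  case U.P i j j' => omega
  case U.X i j i' j' => have := hb i' j'; omega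
  case U.Q i j j' => have := hb i j; omega
  case U.A i j j' => have := hb i j; omega
  case U.T i j k => have := hb i j; omega
  case Q.X j i' j' => have := hb i' j'; omega
  case Q.U j i' j' => have := hb i' j'; omega
  case A.X j i' j' => have := hb i' j'; omega
  case A.U j i' j' => have := hb i' j'; omega
  case T.X j i' j' => have := hb i' j'; omega
  case T.U j i' j' => have := hb i' j'; omega
  all_goals omega

/-- Started with contents `M` of the named registers, the program `L` does not divide by zero and
ends with contents that satisfy `Post`. -/
def Valid (L : SLP) (Post : (Reg n → ℝ) → Prop) (M : Reg n → ℝ) : Prop :=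
  ∀ m : Mem, m ∘ Reg.addr = M → SLP.NoDivByZero m L ∧ Post (SLP.exec m L ∘ Reg.addr)

namespace Valid

variable {L L' : SLP} {Post Post' : (Reg n → ℝ) → Prop} {M : Reg n → ℝ}

theorem nil (h : Post M) : Valid [] Post M := by
  rintro m rfl
  exact ⟨trivial, h⟩

/-- Validity of the second part serves as postcondition of the first, as in a calculus of weakest
preconditions. -/
theorem append (h : Valid L (Valid L' Post) M) : Valid (L ++ L') Post M := by
  intro m hm
  obtain ⟨h1, h2⟩ := h m hm
  have aux : ∀ (L : SLP) (m : Mem), (SLP.exec m (L ++ L') = SLP.exec (SLP.exec m L) L') ∧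
      (SLP.NoDivByZero m L → SLP.NoDivByZero (SLP.exec m L) L' →
        SLP.NoDivByZero m (L ++ L')) := by
    intro L
    induction L with
    | nil => exact fun m => ⟨rfl, fun _ h => h⟩
    | cons c L ih => exact fun m => ⟨(ih _).1, fun h h' => ⟨h.1, (ih _).2 h.2 h'⟩⟩
  obtain ⟨h3, h4⟩ := h2 _ rfl
  exact ⟨(aux L m).2 h1 h3, by rw [(aux L m).1]; exact h4⟩

theorem mono (h : Valid L Post M) (hP : ∀ M, Post M → Post' M) : Valid L Post' M :=
  fun m hm => ⟨(h m hm).1, hP _ (h m hm).2⟩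

theorem cons {c : Instr} {d : Reg n} {r : ℝ}
    (hc : ∀ m : Mem, m ∘ Reg.addr = M → c.Legal m ∧ c.exec m = Function.update m d.addr r)
    (h : Valid L Post (Function.update M d r)) : Valid (c :: L) Post M := by
  intro m hm
  obtain ⟨h1, h2⟩ := hc m hm
  have h3 : Function.update m d.addr r ∘ Reg.addr = Function.update M d r := by
    rw [Function.update_comp_eq_of_injective _ Reg.addr_injective, hm]
  have h4 := h _ h3
  rw [← h2] at h4
  exact ⟨⟨h1, h4.1⟩, h4.2⟩

theorem const {d : Reg n} {q : ℚ} (h : Valid L Post (Function.update M d q)) :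
    Valid (.const d.addr q :: L) Post M :=
  cons (fun _ _ => ⟨trivial, rfl⟩) h

theorem add {d a b : Reg n} (h : Valid L Post (Function.update M d (M a + M b))) :
    Valid (.add d.addr a.addr b.addr :: L) Post M :=
  cons (by rintro m rfl; exact ⟨trivial, rfl⟩) h

theorem sub {d a b : Reg n} (h : Valid L Post (Function.update M d (M a - M b))) :
    Valid (.sub d.addr a.addr b.addr :: L) Post M :=
  cons (by rintro m rfl; exact ⟨trivial, rfl⟩) h

theorem mul {d a b : Reg n} (h : Valid L Post (Function.update M d (M a * M b))) :
    Valid (.mul d.addr a.addr b.addr :: L) Post M :=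
  cons (by rintro m rfl; exact ⟨trivial, rfl⟩) h

theorem div {d a b : Reg n} (hb : M b ≠ 0)
    (h : Valid L Post (Function.update M d (M a / M b))) :
    Valid (.div d.addr a.addr b.addr :: L) Post M :=
  cons (by rintro m rfl; exact ⟨hb, rfl⟩) h

theorem min {d a b : Reg n} (h : Valid L Post (Function.update M d (Min.min (M a) (M b)))) :
    Valid (.min d.addr a.addr b.addr :: L) Post M :=
  cons (by rintro m rfl; exact ⟨trivial, rfl⟩) h

theorem max {d a b : Reg n} (h : Valid L Post (Function.update M d (Max.max (M a) (M b)))) :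
    Valid (.max d.addr a.addr b.addr :: L) Post M :=
  cons (by rintro m rfl; exact ⟨trivial, rfl⟩) h

/-- The rule for loops, with an invariant that depends on the list of indices already done. -/
theorem loop {f : Fin n → SLP} (Inv : List (Fin n) → (Reg n → ℝ) → Prop) (h0 : Inv [] M)
    (hstep : ∀ l a M, a ∉ l → Inv l M → Valid (f a) (Inv (l ++ [a])) M) :
    Valid ((List.finRange n).flatMap f) (Inv (List.finRange n)) M := by
  have key : ∀ (r l : List (Fin n)) (M : Reg n → ℝ), (l ++ r).Nodup → Inv l M →
      Valid (r.flatMap f) (Inv (l ++ r)) M := by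
    intro r
    induction r with
    | nil => intro l M _ h; simpa using nil h
    | cons a r ih =>
      intro l M hnd h
      rw [List.flatMap_cons]
      refine append ((hstep l a M ?_ h).mono fun M' h' => ?_)
      · rw [List.nodup_append] at hnd
        exact fun ha => hnd.2.2 a ha a (by simp) rfl
      · have := ih (l ++ [a]) M' (by simpa using hnd) h'
        simpa using this
  simpa using key (List.finRange n) [] M (by simpa using List.nodup_finRange n) h0

end Valid

/-! ### Continuity of programs -/

/-- Each instruction changes one register, by a continuous operation; for division this uses that
the divisor does not vanish on `D`. -/
theorem SLP.continuousOn_exec {V : Type} [TopologicalSpace V] {D : Set V} (L : SLP) :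
    ∀ m : V → Mem, (∀ k, ContinuousOn (fun v => m v k) D) →
      (∀ v ∈ D, SLP.NoDivByZero (m v) L) → ∀ k, ContinuousOn (fun v => SLP.exec (m v) L k) D := by
  induction L with
  | nil => exact fun m hm _ => hm
  | cons c L ih =>
    intro m hm hL
    refine ih (fun v => c.exec (m v)) (fun k => ?_) fun v hv => (hL v hv).2
    have hupd : ∀ (d : ℕ) (g : V → ℝ), ContinuousOn g D →
        ContinuousOn (fun v => Function.update (m v) d (g v) k) D := by
      intro d g hg
      by_cases hk : k = d
      · simpa [hk] using hg
      · simpa [hk] using hm k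
    cases c with
    | const d q => exact hupd d _ continuousOn_const
    | add d a b => exact hupd d _ ((hm a).add (hm b))
    | sub d a b => exact hupd d _ ((hm a).sub (hm b))
    | mul d a b => exact hupd d _ ((hm a).mul (hm b))
    | div d a b => exact hupd d _ ((hm a).div (hm b) fun v hv => (hL v hv).1)
    | min d a b => exact hupd d _ ((hm a).inf (hm b))
    | max d a b => exact hupd d _ ((hm a).sup (hm b))

theorem SLP.continuousOn_fn {d : ℕ} {D : Set (Fin d → ℝ)} (L : SLP)
    (hL : ∀ v ∈ D, SLP.NoDivByZero (load v) L) : ContinuousOn (SLP.fn L d) D := by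
  refine continuousOn_pi.2 fun k => ?_
  refine SLP.continuousOn_exec L (fun v => load v) (fun k => ?_) hL k
  unfold load
  split_ifs with h
  · exact (continuous_apply _).continuousOn
  · exact continuousOn_const

open Reg

/-! ### The program for the fixed point map -/

/-- The instructions that load the utilities. -/
def utilityProg (u : Fin n → Fin n → ℚ) : SLP :=
  (List.finRange n).flatMap fun i => (List.finRange n).flatMap fun j =>
    [.const (U i j).addr (u i j)]

variable (n) in
/-- The instructions that compute the constants `0`, `1` and `n`. -/
def constProg : SLP :=
  -- The number `n` is obtained by repeated addition of 1, so that no numeral depending on `n` has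
  -- to be written in binary.
  [.const (T 0 : Reg n).addr 0, .const (T 1 : Reg n).addr 1, .const (T 2 : Reg n).addr 0] ++
    (List.finRange n).flatMap fun _ =>
      [.add (T 2 : Reg n).addr (T 2 : Reg n).addr (T 1 : Reg n).addr]

/-- The instructions that compute one adjusted price. -/
def adjustProg (j : Fin n) : SLP :=
  [.sub (T 3 : Reg n).addr (P j).addr (T 1 : Reg n).addr] ++
    ((List.finRange n).flatMap (fun i =>
      [.add (T 3 : Reg n).addr (T 3 : Reg n).addr (X i j).addr]) ++
      [.max (T 3 : Reg n).addr (T 3 : Reg n).addr (T 0 : Reg n).addr,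
        .min (Q j).addr (T 3 : Reg n).addr (T 2 : Reg n).addr])

variable (n) in
/-- The instructions that compute the least adjusted price. -/
def minimumProg : SLP :=
  -- Adding `T 0`, which holds 0, copies a register. Starting the minimum from `n` gives it a value
  -- also when there are no goods.
  [.add (T 4 : Reg n).addr (T 2 : Reg n).addr (T 0 : Reg n).addr] ++
    (List.finRange n).flatMap fun j => [.min (T 4 : Reg n).addr (T 4 : Reg n).addr (Q j).addr]

/-- The instructions that compute the utility and the excess cost of the bundle of an agent. -/
def valueProg (i : Fin n) : SLP :=
  [.add (T 5 : Reg n).addr (T 0 : Reg n).addr (T 0 : Reg n).addr] ++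
    ((List.finRange n).flatMap (fun j =>
      [.mul (T 6 : Reg n).addr (U i j).addr (X i j).addr,
        .add (T 5 : Reg n).addr (T 5 : Reg n).addr (T 6 : Reg n).addr]) ++
    ([.sub (T 7 : Reg n).addr (T 0 : Reg n).addr (T 1 : Reg n).addr] ++
    ((List.finRange n).flatMap (fun j =>
      [.mul (T 6 : Reg n).addr (P j).addr (X i j).addr,
        .add (T 7 : Reg n).addr (T 7 : Reg n).addr (T 6 : Reg n).addr]) ++
    [.max (T 7 : Reg n).addr (T 7 : Reg n).addr (T 0 : Reg n).addr])))

/-- The instructions that add one mixture of two goods to the bundle of an agent. -/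
def mixProg (i b c : Fin n) : SLP :=
  -- `T 5` and `T 7` hold the utility and excess cost of the old bundle, `T 8` the running size, `T
  -- 9` and `T 10` the truncations `max (1 - p b) 0` and `max (p c - 1) 0`; `T 11` becomes the
  -- weight.
  [.sub (T 10 : Reg n).addr (P c).addr (T 1 : Reg n).addr,
    .max (T 10 : Reg n).addr (T 10 : Reg n).addr (T 0 : Reg n).addr,
    .sub (T 11 : Reg n).addr (U i c).addr (T 5 : Reg n).addr,
    .mul (T 11 : Reg n).addr (T 9 : Reg n).addr (T 11 : Reg n).addr,
    .sub (T 12 : Reg n).addr (U i b).addr (T 5 : Reg n).addr,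
    .mul (T 12 : Reg n).addr (T 10 : Reg n).addr (T 12 : Reg n).addr,
    .add (T 11 : Reg n).addr (T 11 : Reg n).addr (T 12 : Reg n).addr,
    .max (T 11 : Reg n).addr (T 11 : Reg n).addr (T 0 : Reg n).addr,
    .add (T 11 : Reg n).addr (T 11 : Reg n).addr (T 7 : Reg n).addr,
    .mul (T 11 : Reg n).addr (T 9 : Reg n).addr (T 11 : Reg n).addr,
    .mul (T 12 : Reg n).addr (T 11 : Reg n).addr (T 9 : Reg n).addr,
    .add (A c).addr (A c).addr (T 12 : Reg n).addr,
    .add (T 8 : Reg n).addr (T 8 : Reg n).addr (T 12 : Reg n).addr,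
    .mul (T 12 : Reg n).addr (T 11 : Reg n).addr (T 10 : Reg n).addr,
    .add (A b).addr (A b).addr (T 12 : Reg n).addr,
    .add (T 8 : Reg n).addr (T 8 : Reg n).addr (T 12 : Reg n).addr]

/-- The instructions that add all mixtures with a good `b`. -/
def mixesProg (i b : Fin n) : SLP :=
  [.sub (T 9 : Reg n).addr (T 1 : Reg n).addr (P b).addr,
    .max (T 9 : Reg n).addr (T 9 : Reg n).addr (T 0 : Reg n).addr] ++
    (List.finRange n).flatMap (fun c => mixProg i b c)

/-- The instructions that update the bundle of an agent. -/
def agentProg (i : Fin n) : SLP :=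
  valueProg i ++
  ([.add (T 8 : Reg n).addr (T 1 : Reg n).addr (T 0 : Reg n).addr] ++
  ((List.finRange n).flatMap (fun j => [.add (A j).addr (X i j).addr (T 0 : Reg n).addr]) ++
  ((List.finRange n).flatMap (fun b => mixesProg i b) ++
  (List.finRange n).flatMap (fun j => [.div (X i j).addr (A j).addr (T 8 : Reg n).addr]))))

variable (n) in
/-- The program after the utilities have been loaded. -/
def mainProg : SLP :=
  constProg n ++
  ((List.finRange n).flatMap adjustProg ++
  (minimumProg n ++
  ((List.finRange n).flatMap agentProg ++
  (List.finRange n).flatMap fun j =>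
    [.sub (P j).addr (Q j).addr (T 4 : Reg n).addr])))

/-! ### Correctness of the program -/

/-- The contents of the registers that are not temporary. -/
structure Holds (p : Fin n → ℝ) (x u : Fin n → Fin n → ℝ) (q : Fin n → ℝ) (t : ℝ)
    (M : Reg n → ℝ) : Prop where
  price : ∀ j, M (P j) = p j
  alloc : ∀ i j, M (X i j) = x i j
  util : ∀ i j, M (U i j) = u i j
  adj : ∀ j, M (Q j) = q j
  zero : M (T 0) = 0
  one : M (T 1) = 1
  size : M (T 2) = n
  least : M (T 4) = t

namespace Holds

variable {p : Fin n → ℝ} {x u : Fin n → Fin n → ℝ} {q : Fin n → ℝ} {t : ℝ} {M : Reg n → ℝ}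

/-- Indices 0, 1, 2 and 4 are reserved for the constants and the least price; for literal indices
the side conditions are decided automatically. -/
theorem update_T (h : Holds p x u q t M) (k : ℕ) (r : ℝ) (hk0 : k ≠ 0 := by decide)
    (hk1 : k ≠ 1 := by decide) (hk2 : k ≠ 2 := by decide) (hk4 : k ≠ 4 := by decide) :
    Holds p x u q t (Function.update M (T k) r) where
  price := by simpa using h.price
  alloc := by simpa using h.alloc
  util := by simpa using h.util
  adj := by simpa using h.adj
  zero := by simpa [hk0.symm] using h.zero
  one := by simpa [hk1.symm] using h.one
  size := by simpa [hk2.symm] using h.size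
  least := by simpa [hk4.symm] using h.least

theorem update_A (h : Holds p x u q t M) (j : Fin n) (r : ℝ) :
    Holds p x u q t (Function.update M (A j) r) where
  price := by simpa using h.price
  alloc := by simpa using h.alloc
  util := by simpa using h.util
  adj := by simpa using h.adj
  zero := by simpa using h.zero
  one := by simpa using h.one
  size := by simpa using h.size
  least := by simpa using h.least

theorem update_Q (h : Holds p x u q t M) (j : Fin n) (r : ℝ) :
    Holds p x u (Function.update q j r) t (Function.update M (Q j) r) where
  price := by simpa using h.price
  alloc := by simpa using h.alloc
  util := by simpa using h.util
  adj k := by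
    by_cases hk : k = j
    · simp [hk]
    · simpa [hk] using h.adj k
  zero := by simpa using h.zero
  one := by simpa using h.one
  size := by simpa using h.size
  least := by simpa using h.least

theorem update_least (h : Holds p x u q t M) (r : ℝ) :
    Holds p x u q r (Function.update M (T 4) r) where
  price := by simpa using h.price
  alloc := by simpa using h.alloc
  util := by simpa using h.util
  adj := by simpa using h.adj
  zero := by simpa using h.zero
  one := by simpa using h.one
  size := by simpa using h.size
  least := by simp

theorem update_X (h : Holds p x u q t M) (i j : Fin n) (r : ℝ) :
    Holds p (Function.update x i (Function.update (x i) j r)) u q t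
      (Function.update M (X i j) r) where
  price := by simpa using h.price
  alloc k l := by
    by_cases hk : k = i
    · subst hk
      by_cases hl : l = j
      · simp [hl]
      · simpa [hl] using h.alloc k l
    · simpa [hk] using h.alloc k l
  util := by simpa using h.util
  adj := by simpa using h.adj
  zero := by simpa using h.zero
  one := by simpa using h.one
  size := by simpa using h.size
  least := by simpa using h.least

end Holds

theorem sum_map_finRange (f : Fin n → ℝ) : ((List.finRange n).map f).sum = ∑ j, f j := by
  rw [← List.ofFn_eq_map, List.sum_ofFn]

section Correctness

variable {p : Fin n → ℝ} {x u : Fin n → Fin n → ℝ} {q : Fin n → ℝ} {t : ℝ} {M : Reg n → ℝ}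

theorem valid_adjustProg (h : Holds p x u q t M) (j : Fin n) :
    Valid (adjustProg j) (Holds p x u (Function.update q j (adjustedPrice p x j)) t) M := by
  refine Valid.append (Valid.sub (Valid.nil (Valid.append ?_)))
  refine (Valid.loop (fun l M => Holds p x u q t M ∧
    M (T 3) = p j - 1 + (l.map fun i => x i j).sum) ⟨h.update_T 3 _, ?_⟩ ?_).mono ?_
  · simp [h.price, h.one]
  · rintro l a M - ⟨hM, h3⟩
    refine Valid.add (Valid.nil ⟨hM.update_T 3 _, ?_⟩)
    simp [h3, hM.alloc, add_assoc]
  · rintro M ⟨hM, h3⟩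
    rw [sum_map_finRange] at h3
    refine Valid.max (Valid.min (Valid.nil ?_))
    have := (hM.update_T 3 (max (M (T 3)) (M (T 0)))).update_Q j (adjustedPrice p x j)
    convert this using 2
    simp [h3, hM.zero, hM.size, adjustedPrice]

theorem valid_adjustProgs (h : Holds p x u q t M) :
    Valid ((List.finRange n).flatMap adjustProg) (Holds p x u (adjustedPrice p x) t) M := by
  refine (Valid.loop (fun l M => ∃ q, Holds p x u q t M ∧ ∀ j ∈ l, q j = adjustedPrice p x j)
    ⟨q, h, by simp⟩ ?_).mono ?_
  · rintro l a M - ⟨q, hM, hq⟩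
    refine (valid_adjustProg hM a).mono fun M' hM' => ⟨_, hM', ?_⟩
    intro j hj
    by_cases hja : j = a
    · simp [hja]
    · simp only [List.mem_append, List.mem_singleton, hja, or_false] at hj
      simp [hja, hq j hj]
  · rintro M ⟨q, hM, hq⟩
    have : q = adjustedPrice p x := funext fun j => hq j (List.mem_finRange j)
    exact this ▸ hM

theorem valid_minimumProg (h : Holds p x u q t M) :
    Valid (minimumProg n) (fun M => ∃ t, Holds p x u q t M ∧ t ≤ n ∧ (∀ j, t ≤ q j) ∧
      (t = n ∨ ∃ j, t = q j)) M := by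
  refine Valid.append (Valid.add (Valid.nil ?_))
  refine (Valid.loop (fun l M => ∃ t, Holds p x u q t M ∧ t ≤ n ∧ (∀ j ∈ l, t ≤ q j) ∧
      (t = n ∨ ∃ j, t = q j)) ⟨_, h.update_least _, ?_, by simp, ?_⟩ ?_).mono ?_
  · simp [h.size, h.zero]
  · simp [h.size, h.zero]
  · rintro l a M - ⟨t, hM, ht, htl, hteq⟩
    refine Valid.min (Valid.nil ⟨_, hM.update_least _, ?_, ?_, ?_⟩)
    · exact (min_le_left _ _).trans (hM.least.trans_le ht)
    · intro j hj
      rw [hM.least, hM.adj]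
      simp only [List.mem_append, List.mem_singleton] at hj
      rcases hj with hj | rfl
      · exact (min_le_left _ _).trans (htl j hj)
      · exact min_le_right _ _
    · rw [hM.least, hM.adj]
      rcases min_choice t (q a) with h | h
      · rw [h]; exact hteq
      · rw [h]; exact Or.inr ⟨a, rfl⟩
  · rintro M ⟨t, hM, ht, htl, hteq⟩
    exact ⟨t, hM, ht, fun j => htl j (List.mem_finRange j), hteq⟩

theorem valid_valueProg (h : Holds p x u q t M) (i : Fin n) :
    Valid (valueProg i) (fun M => Holds p x u q t M ∧ M (T 5) = ∑ j, u i j * x i j ∧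
      M (T 7) = max (∑ j, p j * x i j - 1) 0) M := by
  refine Valid.append (Valid.add (Valid.nil (Valid.append ?_)))
  refine (Valid.loop (fun l M => Holds p x u q t M ∧
    M (T 5) = (l.map fun j => u i j * x i j).sum) ⟨h.update_T 5 _, ?_⟩ ?_).mono ?_
  · simp [h.zero]
  · rintro l a M - ⟨hM, h5⟩
    refine Valid.mul (Valid.add (Valid.nil ⟨(hM.update_T 6 _).update_T 5 _, ?_⟩))
    simp [h5, hM.alloc, hM.util]
  · rintro M ⟨hM, h5⟩
    rw [sum_map_finRange] at h5
    refine Valid.append (Valid.sub (Valid.nil (Valid.append ?_)))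
    refine (Valid.loop (fun l M => Holds p x u q t M ∧ M (T 5) = ∑ j, u i j * x i j ∧
      M (T 7) = (l.map fun j => p j * x i j).sum - 1) ⟨hM.update_T 7 _, ?_, ?_⟩ ?_).mono ?_
    · simpa using h5
    · simp [hM.zero, hM.one]
    · rintro l a M - ⟨hM, h5, h7⟩
      refine Valid.mul (Valid.add (Valid.nil ⟨(hM.update_T 6 _).update_T 7 _, ?_, ?_⟩))
      · simpa using h5
      · simp [h7, hM.alloc, hM.price]
        ring
    · rintro M ⟨hM, h5, h7⟩
      rw [sum_map_finRange] at h7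
      refine Valid.max (Valid.nil ⟨hM.update_T 7 _, ?_, ?_⟩)
      · simpa using h5
      · simp [h7, hM.zero]

/-- The contents of the registers while the bundle of an agent is being computed. -/
structure Mixing (p : Fin n → ℝ) (x u : Fin n → Fin n → ℝ) (q : Fin n → ℝ) (t : ℝ) (i : Fin n)
    (bundle : Fin n → ℝ) (total : ℝ) (M : Reg n → ℝ) : Prop where
  holds : Holds p x u q t M
  value : M (T 5) = ∑ j, u i j * x i j
  excess : M (T 7) = max (∑ j, p j * x i j - 1) 0
  total_eq : M (T 8) = total
  bundle_eq : ∀ j, M (A j) = bundle j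

theorem valid_mixProg {i b c : Fin n} {bundle : Fin n → ℝ} {total : ℝ}
    (h : Mixing p x u q t i bundle total M) (h9 : M (T 9) = max (1 - p b) 0) :
    Valid (mixProg i b c) (fun M => Mixing p x u q t i
      (fun j => bundle j + ((if c = j then mixWeight p (u i) (x i) b c * max (1 - p b) 0 else 0) +
        (if b = j then mixWeight p (u i) (x i) b c * max (p c - 1) 0 else 0)))
      (total + (mixWeight p (u i) (x i) b c * max (1 - p b) 0 +
        mixWeight p (u i) (x i) b c * max (p c - 1) 0)) M ∧ M (T 9) = max (1 - p b) 0) M := by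
  have hH := h.holds
  refine Valid.sub (Valid.max (Valid.sub (Valid.mul (Valid.sub (Valid.mul (Valid.add (Valid.max
    (Valid.add (Valid.mul (Valid.mul (Valid.add (Valid.add (Valid.mul (Valid.add (Valid.add
    (Valid.nil ⟨⟨?_, ?_, ?_, ?_, ?_⟩, ?_⟩))))))))))))))))
  · exact (((((((((((((((hH.update_T 10 _).update_T 10 _).update_T 11 _).update_T 11 _).update_T
      12 _).update_T 12 _).update_T 11 _).update_T 11 _).update_T 11 _).update_T 11 _).update_T
      12 _).update_A c _).update_T 8 _).update_T 12 _).update_A b _).update_T 8 _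
  · simpa using h.value
  · simpa using h.excess
  · simp [hH.price, hH.util, hH.zero, hH.one, h.value, h.excess, h.total_eq, h9, mixWeight,
      add_assoc]
  · intro j
    -- If `b = c`, both parts of the mixture are added to the same register, so the cases must be
    -- treated jointly.
    by_cases hb : b = j <;> by_cases hc : c = j
    · subst hb hc
      simp [hH.price, hH.util, hH.zero, hH.one, h.value, h.excess, h.bundle_eq, h9, mixWeight,
        add_assoc]
    · subst hb
      simp [hc, Ne.symm hc, hH.price, hH.util, hH.zero, hH.one, h.value, h.excess, h.bundle_eq, h9,
        mixWeight]
    · subst hc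
      simp [hb, Ne.symm hb, hH.price, hH.util, hH.zero, hH.one, h.value, h.excess, h.bundle_eq, h9,
        mixWeight]
    · simp [hb, hc, Ne.symm hb, Ne.symm hc, h.bundle_eq]
  · simpa using h9

theorem valid_mixesProg {i b : Fin n} {bundle : Fin n → ℝ} {total : ℝ}
    (h : Mixing p x u q t i bundle total M) :
    Valid (mixesProg i b) (Mixing p x u q t i
      (fun j => bundle j + ∑ c, ((if c = j then mixWeight p (u i) (x i) b c * max (1 - p b) 0
        else 0) + (if b = j then mixWeight p (u i) (x i) b c * max (p c - 1) 0 else 0)))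
      (total + ∑ c, (mixWeight p (u i) (x i) b c * max (1 - p b) 0 +
        mixWeight p (u i) (x i) b c * max (p c - 1) 0))) M := by
  refine Valid.append (Valid.sub (Valid.max (Valid.nil ?_)))
  refine (Valid.loop (fun l M => Mixing p x u q t i
      (fun j => bundle j + (l.map fun c => ((if c = j then mixWeight p (u i) (x i) b c *
        max (1 - p b) 0 else 0) +
        (if b = j then mixWeight p (u i) (x i) b c * max (p c - 1) 0 else 0))).sum)
      (total + (l.map fun c => (mixWeight p (u i) (x i) b c * max (1 - p b) 0 +
        mixWeight p (u i) (x i) b c * max (p c - 1) 0)).sum) M ∧ M (T 9) = max (1 - p b) 0)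
      ⟨⟨(h.holds.update_T 9 _).update_T 9 _, ?_, ?_, ?_, ?_⟩, ?_⟩ ?_).mono ?_
  · simpa using h.value
  · simpa using h.excess
  · simpa using h.total_eq
  · simpa using h.bundle_eq
  · simp [h.holds.one, h.holds.zero, h.holds.price]
  · rintro l c M - ⟨hM, h9⟩
    refine (valid_mixProg hM h9).mono fun M' hM' => ?_
    simpa only [List.map_append, List.sum_append, List.map_cons, List.map_nil, List.sum_cons,
      List.sum_nil, add_zero, add_assoc] using hM'
  · rintro M ⟨hM, -⟩
    simpa only [sum_map_finRange] using hM

theorem valid_agentProg (h : Holds p x u q t M) (i : Fin n) :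
    Valid (agentProg i) (Holds p (Function.update x i fun j =>
      mixBundle p (u i) (x i) j / mixSize p (u i) (x i)) u q t) M := by
  refine Valid.append ((valid_valueProg h i).mono ?_)
  rintro M ⟨hM, h5, h7⟩
  refine Valid.append (Valid.add (Valid.nil (Valid.append ?_)))
  refine (Valid.loop (fun l M => Holds p x u q t M ∧ M (T 5) = ∑ j, u i j * x i j ∧
      M (T 7) = max (∑ j, p j * x i j - 1) 0 ∧ M (T 8) = 1 ∧ ∀ j ∈ l, M (A j) = x i j)
      ⟨hM.update_T 8 _, ?_, ?_, ?_, by simp⟩ ?_).mono ?_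
  · simpa using h5
  · simpa using h7
  · simp [hM.one, hM.zero]
  · rintro l a M - ⟨hM, h5, h7, h8, hA⟩
    refine Valid.add (Valid.nil ⟨hM.update_A a _, ?_, ?_, ?_, ?_⟩)
    · simpa using h5
    · simpa using h7
    · simpa using h8
    · intro j hj
      by_cases hja : j = a
      · simp [hja, hM.alloc, hM.zero]
      · simp only [List.mem_append, List.mem_singleton, hja, or_false] at hj
        simpa [hja] using hA j hj
  rintro M ⟨hM, h5, h7, h8, hA⟩
  refine Valid.append ((Valid.loop (fun l M => Mixing p x u q t i
      (fun j => x i j + (l.map fun b => ∑ c, ((if c = j then mixWeight p (u i) (x i) b c *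
        max (1 - p b) 0 else 0) +
        (if b = j then mixWeight p (u i) (x i) b c * max (p c - 1) 0 else 0))).sum)
      (1 + (l.map fun b => ∑ c, (mixWeight p (u i) (x i) b c * max (1 - p b) 0 +
        mixWeight p (u i) (x i) b c * max (p c - 1) 0)).sum) M)
      ⟨hM, h5, h7, by simpa using h8, ?_⟩ ?_).mono ?_)
  · intro j
    simpa using hA j (List.mem_finRange j)
  · rintro l b M - hM
    refine (valid_mixesProg hM).mono fun M' hM' => ?_
    simpa only [List.map_append, List.sum_append, List.map_cons, List.map_nil, List.sum_cons,
      List.sum_nil, add_zero, add_assoc] using hM'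
  rintro M hM
  simp only [sum_map_finRange] at hM
  have h8 : M (T 8) = mixSize p (u i) (x i) := hM.total_eq
  have hA : ∀ j, M (A j) = mixBundle p (u i) (x i) j := hM.bundle_eq
  have hpos := one_le_mixSize p (u i) (x i)
  refine (Valid.loop (fun l M => M (T 8) = mixSize p (u i) (x i) ∧
    (∀ j, M (A j) = mixBundle p (u i) (x i) j) ∧ ∃ y, Holds p (Function.update x i y) u q t M ∧
      ∀ j ∈ l, y j = mixBundle p (u i) (x i) j / mixSize p (u i) (x i))
    ⟨h8, hA, x i, by simpa using hM.holds, by simp⟩ ?_).mono ?_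
  · rintro l a M - ⟨h8, hA, y, hM, hy⟩
    refine Valid.div (by rw [h8]; positivity) (Valid.nil ⟨by simpa using h8, by simpa using hA,
      Function.update y a (M (A a) / M (T 8)), ?_, ?_⟩)
    · simpa using hM.update_X i a (M (A a) / M (T 8))
    · intro j hj
      by_cases hja : j = a
      · simp [hja, hA, h8]
      · simp only [List.mem_append, List.mem_singleton, hja, or_false] at hj
        simpa [hja] using hy j hj
  · rintro M ⟨-, -, y, hM, hy⟩
    have : y = fun j => mixBundle p (u i) (x i) j / mixSize p (u i) (x i) :=
      funext fun j => hy j (List.mem_finRange j)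
    exact this ▸ hM

/-- Shares are overwritten in place. The invariant keeps the rows outside `l` unchanged, and `a ∉ l`
ensures that agent `a` still starts from the old bundle. -/
theorem valid_agentProgs (h : Holds p x u q t M) :
    Valid ((List.finRange n).flatMap agentProg) (Holds p (fun i j =>
      mixBundle p (u i) (x i) j / mixSize p (u i) (x i)) u q t) M := by
  refine (Valid.loop (fun l M => ∃ y, Holds p y u q t M ∧ (∀ i ∉ l, y i = x i) ∧
    ∀ i ∈ l, y i = fun j => mixBundle p (u i) (x i) j / mixSize p (u i) (x i))
    ⟨x, h, by simp, by simp⟩ ?_).mono ?_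
  · rintro l a M ha ⟨y, hM, hy, hy'⟩
    refine (valid_agentProg hM a).mono fun M' hM' => ⟨_, hM', ?_, ?_⟩
    · intro i hi
      simp only [List.mem_append, List.mem_singleton, not_or] at hi
      simpa [hi.2] using hy i hi.1
    · intro i hi
      by_cases hia : i = a
      · subst hia
        simp [hy i ha]
      · simp only [List.mem_append, List.mem_singleton, hia, or_false] at hi
        simpa [hia] using hy' i hi
  · rintro M ⟨y, hM, -, hy⟩
    have : y = fun i j => mixBundle p (u i) (x i) j / mixSize p (u i) (x i) :=
      funext fun i => hy i (List.mem_finRange i)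
    exact this ▸ hM

/-- The order of the phases makes the update simultaneous: adjusted prices are computed before any
share changes, and prices are overwritten last, so every agent sees the old ones. -/
theorem valid_mainProg (hP : ∀ j, M (P j) = p j) (hX : ∀ i j, M (X i j) = x i j)
    (hU : ∀ i j, M (U i j) = u i j) :
    Valid (mainProg n) (fun M => (∀ i j, M (X i j) =
      mixBundle p (u i) (x i) j / mixSize p (u i) (x i)) ∧
      ∃ t : ℝ, t ≤ n ∧ (∀ j, t ≤ adjustedPrice p x j) ∧
        (t = n ∨ ∃ j, t = adjustedPrice p x j) ∧ ∀ j, M (P j) = adjustedPrice p x j - t) M := by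
  have hconst : Valid (constProg n) (fun M' => ∃ q t, Holds p x u q t M') M := by
    refine Valid.append (Valid.const (Valid.const (Valid.const (Valid.nil ?_))))
    refine (Valid.loop (fun l M => (∀ j, M (P j) = p j) ∧ (∀ i j, M (X i j) = x i j) ∧
      (∀ i j, M (U i j) = u i j) ∧ M (T 0) = 0 ∧ M (T 1) = 1 ∧ M (T 2) = l.length) ?_ ?_).mono ?_
    · simp [hP, hX, hU]
    · rintro l a M - ⟨hP, hX, hU, h0, h1, h2⟩
      refine Valid.add (Valid.nil ?_)
      simp [hP, hX, hU, h0, h1, h2]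
    · rintro M ⟨hP, hX, hU, h0, h1, h2⟩
      exact ⟨_, _, hP, hX, hU, fun _ => rfl, h0, h1, by simpa using h2, rfl⟩
  refine Valid.append (hconst.mono ?_)
  rintro M ⟨q, t, hM⟩
  refine Valid.append ((valid_adjustProgs hM).mono fun M hM => ?_)
  refine Valid.append ((valid_minimumProg hM).mono ?_)
  rintro M ⟨t, hM, htn, htle, hteq⟩
  refine Valid.append ((valid_agentProgs hM).mono fun M hM => ?_)
  refine (Valid.loop (fun l M => (∀ i j, M (X i j) =
      mixBundle p (u i) (x i) j / mixSize p (u i) (x i)) ∧ (∀ j, M (Q j) = adjustedPrice p x j) ∧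
      M (T 4) = t ∧ ∀ j ∈ l, M (P j) = adjustedPrice p x j - t)
      ⟨hM.alloc, hM.adj, hM.least, by simp⟩ ?_).mono ?_
  · rintro l a M - ⟨hX, hQ, h4, hP⟩
    refine Valid.sub (Valid.nil ⟨by simpa using hX, by simpa using hQ, by simpa using h4, ?_⟩)
    intro j hj
    by_cases hja : j = a
    · simp [hja, hQ, h4]
    · simp only [List.mem_append, List.mem_singleton, hja, or_false] at hj
      simpa [hja] using hP j hj
  · rintro M ⟨hX, -, -, hP⟩
    exact ⟨hX, t, htn, htle, hteq, fun j => hP j (List.mem_finRange j)⟩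

end Correctness

theorem valid_utilityProg (u : Fin n → Fin n → ℚ) (M : Reg n → ℝ) :
    Valid (utilityProg u) (fun M' => (∀ j, M' (P j) = M (P j)) ∧
      (∀ i j, M' (X i j) = M (X i j)) ∧ ∀ i j, M' (U i j) = u i j) M := by
  refine (Valid.loop (fun l M' => (∀ j, M' (P j) = M (P j)) ∧
    (∀ i j, M' (X i j) = M (X i j)) ∧ ∀ i ∈ l, ∀ j, M' (U i j) = u i j)
    ⟨fun _ => rfl, fun _ _ => rfl, by simp⟩ ?_).mono ?_
  · rintro l a M₁ - ⟨hP, hX, hU⟩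
    refine (Valid.loop (fun l' M' => (∀ j, M' (P j) = M (P j)) ∧
      (∀ i j, M' (X i j) = M (X i j)) ∧ (∀ i ∈ l, ∀ j, M' (U i j) = u i j) ∧
      ∀ j ∈ l', M' (U a j) = u a j) ⟨hP, hX, hU, by simp⟩ ?_).mono ?_
    · rintro l' b M₂ - ⟨hP, hX, hU, hU'⟩
      refine Valid.const (Valid.nil ⟨by simpa using hP, by simpa using hX, ?_, ?_⟩)
      · intro i hi j
        by_cases hij : i = a ∧ j = b
        · simp [hij]
        · rw [Function.update_of_ne (by simpa using hij)]
          exact hU i hi j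
      · intro j hj
        by_cases hjb : j = b
        · simp [hjb]
        · simp only [List.mem_append, List.mem_singleton, hjb, or_false] at hj
          simpa [hjb] using hU' j hj
    · rintro M₂ ⟨hP, hX, hU, hU'⟩
      refine ⟨hP, hX, fun i hi j => ?_⟩
      simp only [List.mem_append, List.mem_singleton] at hi
      rcases hi with hi | rfl
      · exact hU i hi j
      · exact hU' j (List.mem_finRange j)
  · rintro M' ⟨hP, hX, hU⟩
    exact ⟨hP, hX, fun i => hU i (List.mem_finRange i)⟩

/-! ### The domain as a polyhedron -/

/-- The linear inequalities for the domain. The bound `p j ≤ n` is expressed by means of the sum of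
all shares, which is `n`. -/
def domainIneqs (n : ℕ) : List LinIneq :=
  (List.finRange n).flatMap (fun j =>
    [⟨[((Reg.P j).addr, -1)], 0⟩,
      -- With the sum of all shares in place of `n`, only the numbers 0, 1 and -1 occur, and no
      -- binary numeral for `n` has to be generated.
      ⟨[((Reg.P j).addr, 1)] ++ (List.finRange n).flatMap (fun i =>
        (List.finRange n).flatMap fun k => [((Reg.X i k).addr, -1)]), 0⟩]) ++
  (List.finRange n).flatMap (fun i =>
    (List.finRange n).flatMap (fun j => [⟨[((Reg.X i j).addr, -1)], 0⟩]) ++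
    [⟨(List.finRange n).flatMap fun j => [((Reg.X i j).addr, 1)], 1⟩,
      ⟨(List.finRange n).flatMap fun j => [((Reg.X i j).addr, -1)], -1⟩])

theorem load_addr_P (v : Fin (n + n * n) → ℝ) (j : Fin n) :
    load v (Reg.P j).addr = priceOf v j := by
  have : (j : ℕ) < n + n * n := by omega
  exact dif_pos this

theorem load_addr_X (v : Fin (n + n * n) → ℝ) (i j : Fin n) :
    load v (Reg.X i j).addr = allocOf v i j := by
  have : n + ((i : ℕ) * n + j) < n + n * n := by have := mul_add_lt_mul i j; omega
  refine (dif_pos this).trans ?_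
  unfold allocOf
  congr 1
  apply Fin.ext
  simp only [Reg.addr, Fin.val_natAdd, finProdFinEquiv_apply_val]
  ring

theorem sum_map_flatMap_finRange {α : Type} (f : Fin n → List α) (g : α → ℝ) :
    (((List.finRange n).flatMap f).map g).sum = ∑ i, ((f i).map g).sum := by
  have : ∀ l : List (Fin n), ((l.flatMap f).map g).sum =
      (l.map fun i => ((f i).map g).sum).sum := by
    intro l
    induction l with
    | nil => rfl
    | cons a l ih => simp [ih]
  rw [this, sum_map_finRange]

theorem hzDomain_eq_polyhedron (I : HZInstance) :
    hzDomain I = polyhedron (I.1 + I.1 * I.1) (domainIneqs I.1) := by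
  obtain ⟨n, u⟩ := I
  ext v
  have key : v ∈ polyhedron (n + n * n) (domainIneqs n) ↔
      (∀ j, 0 ≤ priceOf v j ∧ priceOf v j ≤ ∑ i, ∑ k, allocOf v i k) ∧
      ∀ i, (∀ j, 0 ≤ allocOf v i j) ∧ ∑ j, allocOf v i j ≤ 1 ∧ 1 ≤ ∑ j, allocOf v i j := by
    simp [polyhedron, domainIneqs, or_imp, forall_and, LinIneq.Holds, sum_map_flatMap_finRange,
      load_addr_P, load_addr_X]
    intro _ _ _ _
    exact ⟨fun h i j => by simpa [load_addr_X] using h _ i j rfl,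
      by rintro h _ i j rfl; simpa [load_addr_X] using h i j⟩
  rw [key]
  constructor
  · rintro ⟨h1, h2⟩
    have : ∑ i, ∑ k, allocOf v i k = n := by simp [fun i => (h2 i).2]
    exact ⟨fun j => ⟨(h1 j).1, (h1 j).2.trans_eq this.symm⟩,
      fun i => ⟨(h2 i).1, (h2 i).2.le, (h2 i).2.ge⟩⟩
  · rintro ⟨h1, h2⟩
    have h3 : ∀ i, ∑ k, allocOf v i k = 1 := fun i => le_antisymm (h2 i).2.1 (h2 i).2.2
    have : ∑ i, ∑ k, allocOf v i k = n := by simp [h3]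
    exact ⟨fun j => ⟨(h1 j).1, (h1 j).2.trans_eq this⟩, fun i => ⟨(h2 i).1, h3 i⟩⟩

theorem hzDomain_nonempty (I : HZInstance) : (hzDomain I).Nonempty := by
  obtain ⟨n, u⟩ := I
  refine ⟨Fin.append (fun _ => 0) fun k =>
    if (finProdFinEquiv.symm k).1 = (finProdFinEquiv.symm k).2 then 1 else 0, ?_⟩
  simp only [hzDomain, priceOf, allocOf, Set.mem_ofPred_eq, Fin.append_left, Fin.append_right,
    Equiv.symm_apply_apply]
  refine ⟨fun _ => ⟨le_rfl, Nat.cast_nonneg n⟩, fun i => ⟨fun j => ?_, by simp⟩⟩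
  split_ifs <;> norm_num

theorem hzDomain_isCompact (I : HZInstance) : IsCompact (hzDomain I) := by
  obtain ⟨n, u⟩ := I
  have hP : ∀ j, Continuous fun v : Fin (n + n * n) → ℝ => priceOf v j :=
    fun j => continuous_apply _
  have hX : ∀ i j, Continuous fun v : Fin (n + n * n) → ℝ => allocOf v i j :=
    fun i j => continuous_apply _
  have hclosed : IsClosed (hzDomain ⟨n, u⟩) := by
    simp only [hzDomain, Set.ofPred_and, Set.ofPred_forall]
    refine IsClosed.inter (isClosed_iInter fun j => IsClosed.inter ?_ ?_)
      (isClosed_iInter fun i => IsClosed.inter (isClosed_iInter fun j => ?_) ?_)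
    · exact isClosed_le continuous_const (hP j)
    · exact isClosed_le (hP j) continuous_const
    · exact isClosed_le continuous_const (hX i j)
    · exact isClosed_eq (continuous_finsetSum _ fun j _ => hX i j) continuous_const
  -- The bound `n + 1` dominates both the prices, at most `n`, and the shares, at most 1.
  refine (isCompact_Icc (a := fun _ : Fin (n + n * n) => (0 : ℝ))
    (b := fun _ => (n : ℝ) + 1)).of_isClosed_subset hclosed ?_
  rintro v ⟨h1, h2⟩
  have hX1 : ∀ i j, 0 ≤ allocOf v i j ∧ allocOf v i j ≤ 1 := fun i j =>
    ⟨(h2 i).1 j, (h2 i).2 ▸ Finset.single_le_sum (f := fun j => allocOf v i j)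
      (fun k _ => (h2 i).1 k) (Finset.mem_univ j)⟩
  have hn : (0 : ℝ) ≤ n := Nat.cast_nonneg n
  have hk : ∀ k, 0 ≤ v k ∧ v k ≤ n + 1 := by
    refine Fin.addCases (fun j => ?_) fun k => ?_
    · have := h1 j
      simp only [priceOf] at this
      exact ⟨this.1, by linarith⟩
    · obtain ⟨⟨i, j⟩, rfl⟩ := finProdFinEquiv.surjective k
      have := hX1 i j
      simp only [allocOf] at this
      exact ⟨this.1, by linarith⟩
  exact ⟨fun k => (hk k).1, fun k => (hk k).2⟩

theorem hzDomain_convex (I : HZInstance) : Convex ℝ (hzDomain I) := by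
  obtain ⟨n, u⟩ := I
  rintro v ⟨hv1, hv2⟩ w ⟨hw1, hw2⟩ a b ha hb hab
  have hP : ∀ j, priceOf (a • v + b • w) j = a * priceOf v j + b * priceOf w j := fun j => rfl
  have hX : ∀ i j, allocOf (a • v + b • w) i j = a * allocOf v i j + b * allocOf w i j :=
    fun i j => rfl
  refine ⟨fun j => ?_, fun i => ⟨fun j => ?_, ?_⟩⟩
  · rw [hP]
    have h1 := hv1 j
    have h2 := hw1 j
    refine ⟨add_nonneg (mul_nonneg ha h1.1) (mul_nonneg hb h2.1), ?_⟩
    calc a * priceOf v j + b * priceOf w j ≤ a * n + b * n :=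
          add_le_add (mul_le_mul_of_nonneg_left h1.2 ha) (mul_le_mul_of_nonneg_left h2.2 hb)
      _ = n := by rw [← add_mul, hab, one_mul]
  · rw [hX]
    exact add_nonneg (mul_nonneg ha ((hv2 i).1 j)) (mul_nonneg hb ((hw2 i).1 j))
  · simp only [hX, Finset.sum_add_distrib, ← Finset.mul_sum, (hv2 i).2, (hw2 i).2, mul_one, hab]

/-! ### The program on the domain -/

/-- The straight-line program of an instance. -/
def hzProg (I : HZInstance) : SLP := utilityProg I.2 ++ mainProg I.1

/-- No membership in the domain is needed, since the only divisors are the sizes `mixSize`, which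
are at least 1 everywhere. -/
theorem hzProg_spec (I : HZInstance) (v : Fin (I.1 + I.1 * I.1) → ℝ) :
    SLP.NoDivByZero (load v) (hzProg I) ∧
      (∀ i j, allocOf (SLP.fn (hzProg I) _ v) i j =
        mixBundle (priceOf v) (fun j => (I.2 i j : ℝ)) (allocOf v i) j /
          mixSize (priceOf v) (fun j => (I.2 i j : ℝ)) (allocOf v i)) ∧
      ∃ t : ℝ, 0 ≤ t ∧ t ≤ I.1 ∧ (∀ j, t ≤ adjustedPrice (priceOf v) (allocOf v) j) ∧
        (t = I.1 ∨ ∃ j, t = adjustedPrice (priceOf v) (allocOf v) j) ∧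
        ∀ j, priceOf (SLP.fn (hzProg I) _ v) j =
          adjustedPrice (priceOf v) (allocOf v) j - t := by
  obtain ⟨n, u⟩ := I
  have h : Valid (utilityProg u ++ mainProg n) _ (load v ∘ Reg.addr) :=
    Valid.append ((valid_utilityProg u _).mono fun M hM =>
      valid_mainProg (p := priceOf v) (x := allocOf v) (u := fun i j => (u i j : ℝ))
        (fun j => (hM.1 j).trans (load_addr_P v j))
        (fun i j => (hM.2.1 i j).trans (load_addr_X v i j)) hM.2.2)
  obtain ⟨h1, h2, t, ht, htle, hteq, hP⟩ := h _ rfl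
  refine ⟨h1, fun i j => ?_, t, ?_, ht, htle, hteq, hP⟩
  · rw [← h2 i j]
    simp only [allocOf, SLP.fn, Function.comp, Reg.addr, Fin.val_natAdd, finProdFinEquiv_apply_val]
    congr 1
    ring
  · have hn : (0 : ℝ) ≤ n := Nat.cast_nonneg n
    rcases hteq with h | ⟨j, h⟩
    · exact h ▸ hn
    · exact h ▸ le_min (le_max_right _ _) hn

theorem hzProg_mapsTo (I : HZInstance) :
    Set.MapsTo (SLP.fn (hzProg I) (I.1 + I.1 * I.1)) (hzDomain I) (hzDomain I) := by
  rintro v ⟨-, hx⟩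
  obtain ⟨-, hX, t, ht, htn, htle, -, hP⟩ := hzProg_spec I v
  refine ⟨fun j => ?_, fun i => ⟨fun j => ?_, ?_⟩⟩
  · rw [hP]
    have h1 : adjustedPrice (priceOf v) (allocOf v) j ≤ I.1 := min_le_right _ _
    exact ⟨sub_nonneg.2 (htle j), by linarith⟩
  · rw [hX]
    exact div_nonneg (mixBundle_nonneg (hx i).1 j) (zero_le_one.trans (one_le_mixSize ..))
  · simp only [hX, ← Finset.sum_div]
    rw [sum_mixBundle (hx i).2]
    exact div_self (zero_lt_one.trans_le (one_le_mixSize ..)).ne'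

theorem hzProg_fixed (I : HZInstance) {v : Fin (I.1 + I.1 * I.1) → ℝ} (hv : v ∈ hzDomain I)
    (hfix : SLP.fn (hzProg I) (I.1 + I.1 * I.1) v = v) :
    IsHZEquilibrium (fun i j => (I.2 i j : ℝ)) (priceOf v) (allocOf v) := by
  obtain ⟨-, hX, t, ht, -, htle, hteq, hP⟩ := hzProg_spec I v
  rw [hfix] at hX hP
  refine isHZEquilibrium_of_fixed (fun j => (hv.1 j).1) (fun i => (hv.2 i).1)
    (fun i => (hv.2 i).2) ht htle hteq hP fun i j => ?_
  have hpos := one_le_mixSize (priceOf v) (fun j => (I.2 i j : ℝ)) (allocOf v i)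
  have := hX i j
  rw [eq_div_iff (by positivity)] at this
  rw [← this, mul_comm]

/-! ### Generators for the linear system and the program -/

/-- `g` generates the encodings of the entries of `l`. -/
def Emits {α : Type} (f : α → List Tok) (g : Gen) (e : Var → ℕ) (l : List α) : Prop :=
  g.word e = l.flatMap fun a => Tok.item :: f a

/-- Apart from the final `sep`, encodings of lists concatenate. `Emits` therefore leaves it out and
`Emits.sep` adds it at the end. -/
theorem encList_eq {α : Type} (f : α → List Tok) (l : List α) :
    encList f l = (l.flatMap fun a => Tok.item :: f a) ++ [Tok.sep] := by
  induction l with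
  | nil => rfl
  | cons a l ih => simp [encList, ih]

namespace Emits

variable {α : Type} {f : α → List Tok} {g g' : Gen} {e : Var → ℕ}

theorem seq {l l' : List α} (h : Emits f g e l) (h' : Emits f g' e l') :
    Emits f (g.seq g') e (l ++ l') := by
  unfold Emits at *
  rw [Gen.word, h, h', List.flatMap_append]

theorem cons {a : α} {l : List α} (h : Emits f g e [a]) (h' : Emits f g' e l) :
    Emits f (g.seq g') e (a :: l) := h.seq h'

theorem loop {v : Var} {l : Fin n → List α} (he : e .size = n)
    (h : ∀ k : Fin n, Emits f g (Function.update e v k) (l k)) :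
    Emits f (.loop v .size g) e ((List.finRange n).flatMap l) := by
  unfold Emits at *
  rw [Gen.word, he, ← List.map_coe_finRange_eq_range, List.flatMap_map, List.flatMap_assoc]
  exact List.flatMap_congr fun k _ => h k

theorem sep {l : List α} (h : Emits f g e l) : (g.seq (.tok .sep)).word e = encList f l := by
  rw [Gen.word, h, encList_eq]
  rfl

end Emits

/-- Registers named by variables. -/
inductive VReg : Type
  | P (j : Var)
  | X (i j : Var)
  | U (i j : Var)
  | Q (j : Var)
  | A (j : Var)
  | T (k : ℕ)

namespace VReg

/-- The number of the register. -/
def num (e : Var → ℕ) : VReg → ℕ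
  | P j => e j
  | X i j => e .size + (e i * e .size + e j)
  | U i j => e .size + e .size * e .size + (e i * e .size + e j)
  | Q j => e .size + e .size * e .size + e .size * e .size + e j
  | A j => e .size + e .size * e .size + e .size * e .size + e .size + e j
  | T k => e .size + e .size * e .size + e .size * e .size + e .size + e .size + k

/-- As many marks as the value of `v`. -/
def marks (v : Var) : Gen := .loop .aux v (.tok .mark)

/-- As many marks as the value of `v` times the size. -/
def marksMul (v : Var) : Gen := .loop .aux v (.loop .aux₂ .size (.tok .mark))

theorem flatMap_range_replicate (m k : ℕ) :
    ((List.range m).flatMap fun _ => List.replicate k Tok.mark) =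
      List.replicate (m * k) Tok.mark := by
  rw [List.eq_replicate_iff]
  simp

theorem word_marks (v : Var) (e : Var → ℕ) : (marks v).word e = List.replicate (e v) .mark := by
  have := flatMap_range_replicate (e v) 1
  rwa [mul_one] at this

theorem word_marksMul (v : Var) (e : Var → ℕ) :
    (marksMul v).word e = List.replicate (e v * e .size) .mark := by
  have h : ∀ k, (Gen.loop .aux₂ .size (.tok .mark)).word (Function.update e .aux k) =
      List.replicate (e .size) .mark := by
    intro k
    have := flatMap_range_replicate (e .size) 1
    rw [mul_one] at this
    simpa [Gen.word] using this
  rw [marksMul, Gen.word]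
  simp only [h, flatMap_range_replicate]

/-- The word generated by `g` followed by `k` marks. -/
def addMarks (g : Gen) : ℕ → Gen
  | 0 => g
  | k + 1 => (addMarks g k).seq (.tok .mark)

theorem word_addMarks {g : Gen} {e : Var → ℕ} {m : ℕ} (h : g.word e = List.replicate m .mark)
    (k : ℕ) : (addMarks g k).word e = List.replicate (m + k) .mark := by
  induction k with
  | zero => exact h
  | succ k ih =>
    rw [addMarks, Gen.word, ih, ← add_assoc, List.replicate_succ']
    rfl

/-- As many marks as the number of the register. -/
def gen : VReg → Gen
  | P j => marks j
  | X i j => (marks .size).seq ((marksMul i).seq (marks j))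
  | U i j => ((marks .size).seq (marksMul .size)).seq ((marksMul i).seq (marks j))
  | Q j => (((marks .size).seq (marksMul .size)).seq (marksMul .size)).seq (marks j)
  | A j =>
    ((((marks .size).seq (marksMul .size)).seq (marksMul .size)).seq (marks .size)).seq (marks j)
  | T k =>
    addMarks (((((marks .size).seq (marksMul .size)).seq (marksMul .size)).seq (marks .size)).seq
      (marks .size)) k

/-- The number of the register in unary, with end mark. -/
def unary (r : VReg) : Gen := r.gen.seq (.tok .sep)

theorem word_unary (r : VReg) (e : Var → ℕ) : r.unary.word e = encUnary (r.num e) := by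
  have key : r.gen.word e = List.replicate (r.num e) .mark := by
    cases r with
    | T k =>
      refine word_addMarks ?_ k
      simp only [Gen.word, word_marks, word_marksMul, List.replicate_append_replicate]
    | _ =>
      simp only [gen, Gen.word, word_marks, word_marksMul, List.replicate_append_replicate, num]
  rw [unary, Gen.word, key]
  rfl

end VReg

/-- The rational numbers that occur in the linear system and the program. -/
inductive SmallRat : Type
  | zero
  | one
  | neg

namespace SmallRat

def toRat : SmallRat → ℚ
  | zero => 0
  | one => 1
  | neg => -1

def gen : SmallRat → Gen
  -- The numerator 0 has no binary digits.
  | zero => (Gen.tok .slash).seq ((Gen.tok (.bit true)).seq (.tok .sep))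
  | one => (Gen.tok (.bit true)).seq ((Gen.tok .slash).seq ((Gen.tok (.bit true)).seq (.tok .sep)))
  | neg => (Gen.tok .minus).seq ((Gen.tok (.bit true)).seq
      ((Gen.tok .slash).seq ((Gen.tok (.bit true)).seq (.tok .sep))))

theorem word_gen (q : SmallRat) (e : Var → ℕ) : q.gen.word e = encRat q.toRat := by
  cases q <;> simp [gen, Gen.word, toRat, encRat, encBits, Computability.encodeNat,
    Computability.encodeNum, Computability.encodePosNum]

end SmallRat

/-- The generator of an instruction that assigns a constant. -/
def constGen (d : VReg) (q : SmallRat) : Gen :=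
  (Gen.tok .item).seq ((Gen.tok .opConst).seq (d.unary.seq q.gen))

/-- The generator of an instruction with token `o`. -/
def opGen (o : Tok) (d a b : VReg) : Gen :=
  (Gen.tok .item).seq ((Gen.tok o).seq (d.unary.seq (a.unary.seq b.unary)))

theorem word_opGen (o : Tok) (d a b : VReg) (e : Var → ℕ) :
    (opGen o d a b).word e =
      .item :: o :: (encUnary (d.num e) ++ (encUnary (a.num e) ++ encUnary (b.num e))) := by
  simp only [opGen, Gen.word, VReg.word_unary, List.singleton_append]

namespace Emits

variable {e : Var → ℕ} {d a b : VReg} {x y z : ℕ}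

theorem const {q : SmallRat} {r : ℚ} (hd : d.num e = x) (hq : q.toRat = r) :
    Emits encInstr (constGen d q) e [.const x r] := by
  subst hd hq
  simp [Emits, constGen, Gen.word, VReg.word_unary, SmallRat.word_gen, encInstr]

theorem add (hd : d.num e = x) (ha : a.num e = y) (hb : b.num e = z) :
    Emits encInstr (opGen .opAdd d a b) e [.add x y z] := by
  subst hd ha hb; simp [Emits, word_opGen, encInstr]

theorem sub (hd : d.num e = x) (ha : a.num e = y) (hb : b.num e = z) :
    Emits encInstr (opGen .opSub d a b) e [.sub x y z] := by
  subst hd ha hb; simp [Emits, word_opGen, encInstr]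

theorem mul (hd : d.num e = x) (ha : a.num e = y) (hb : b.num e = z) :
    Emits encInstr (opGen .opMul d a b) e [.mul x y z] := by
  subst hd ha hb; simp [Emits, word_opGen, encInstr]

theorem div (hd : d.num e = x) (ha : a.num e = y) (hb : b.num e = z) :
    Emits encInstr (opGen .opDiv d a b) e [.div x y z] := by
  subst hd ha hb; simp [Emits, word_opGen, encInstr]

theorem min (hd : d.num e = x) (ha : a.num e = y) (hb : b.num e = z) :
    Emits encInstr (opGen .opMin d a b) e [.min x y z] := by
  subst hd ha hb; simp [Emits, word_opGen, encInstr]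

theorem max (hd : d.num e = x) (ha : a.num e = y) (hb : b.num e = z) :
    Emits encInstr (opGen .opMax d a b) e [.max x y z] := by
  subst hd ha hb; simp [Emits, word_opGen, encInstr]

end Emits

open VReg

/-! ### The generator of the program -/

/-- Generates `constProg`. -/
def constProgGen : Gen :=
  ((constGen (T 0) .zero).seq ((constGen (T 1) .one).seq (constGen (T 2) .zero))).seq
    (.loop .agent .size (opGen .opAdd (T 2) (T 2) (T 1)))

/-- Generates `adjustProg`. -/
def adjustGen : Gen :=
  (opGen .opSub (T 3) (P .good) (T 1)).seq
    ((Gen.loop .agent .size (opGen .opAdd (T 3) (T 3) (X .agent .good))).seq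
      ((opGen .opMax (T 3) (T 3) (T 0)).seq (opGen .opMin (Q .good) (T 3) (T 2))))

/-- Generates `minimumProg`. -/
def minimumGen : Gen :=
  (opGen .opAdd (T 4) (T 2) (T 0)).seq
    (.loop .good .size (opGen .opMin (T 4) (T 4) (Q .good)))

/-- Generates `valueProg`. -/
def valueGen : Gen :=
  (opGen .opAdd (T 5) (T 0) (T 0)).seq
    ((Gen.loop .good .size ((opGen .opMul (T 6) (U .agent .good) (X .agent .good)).seq
      (opGen .opAdd (T 5) (T 5) (T 6)))).seq
    ((opGen .opSub (T 7) (T 0) (T 1)).seq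
    ((Gen.loop .good .size ((opGen .opMul (T 6) (P .good) (X .agent .good)).seq
      (opGen .opAdd (T 7) (T 7) (T 6)))).seq
    (opGen .opMax (T 7) (T 7) (T 0)))))

/-- Generates `mixProg`. -/
def mixGen : Gen :=
  (opGen .opSub (T 10) (P .high) (T 1)).seq <|
  (opGen .opMax (T 10) (T 10) (T 0)).seq <|
  (opGen .opSub (T 11) (U .agent .high) (T 5)).seq <|
  (opGen .opMul (T 11) (T 9) (T 11)).seq <|
  (opGen .opSub (T 12) (U .agent .low) (T 5)).seq <|
  (opGen .opMul (T 12) (T 10) (T 12)).seq <|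
  (opGen .opAdd (T 11) (T 11) (T 12)).seq <|
  (opGen .opMax (T 11) (T 11) (T 0)).seq <|
  (opGen .opAdd (T 11) (T 11) (T 7)).seq <|
  (opGen .opMul (T 11) (T 9) (T 11)).seq <|
  (opGen .opMul (T 12) (T 11) (T 9)).seq <|
  (opGen .opAdd (A .high) (A .high) (T 12)).seq <|
  (opGen .opAdd (T 8) (T 8) (T 12)).seq <|
  (opGen .opMul (T 12) (T 11) (T 10)).seq <|
  (opGen .opAdd (A .low) (A .low) (T 12)).seq <|
  opGen .opAdd (T 8) (T 8) (T 12)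

/-- Generates `mixesProg`. -/
def mixesGen : Gen :=
  ((opGen .opSub (T 9) (T 1) (P .low)).seq (opGen .opMax (T 9) (T 9) (T 0))).seq
    (.loop .high .size mixGen)

/-- Generates `agentProg`. -/
def agentGen : Gen :=
  valueGen.seq <|
  (opGen .opAdd (T 8) (T 1) (T 0)).seq <|
  (Gen.loop .good .size (opGen .opAdd (A .good) (X .agent .good) (T 0))).seq <|
  (Gen.loop .low .size mixesGen).seq <|
  Gen.loop .good .size (opGen .opDiv (X .agent .good) (A .good) (T 8))

/-- Generates `mainProg`. -/
def mainGen : Gen :=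
  constProgGen.seq <|
  (Gen.loop .good .size adjustGen).seq <|
  minimumGen.seq <|
  (Gen.loop .agent .size agentGen).seq <|
  Gen.loop .good .size (opGen .opSub (P .good) (Q .good) (T 4))

theorem emits_constProgGen {e : Var → ℕ} (he : e .size = n) :
    Emits encInstr constProgGen e (constProg n) := by
  refine .seq (.cons (.const ?_ ?_) (.cons (.const ?_ ?_) (.const ?_ ?_)))
    (.loop he fun _ => .add ?_ ?_ ?_) <;> simp [num, Reg.addr, he, SmallRat.toRat]

theorem emits_adjustGen {e : Var → ℕ} (he : e .size = n) {j : Fin n} (hj : e .good = j) :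
    Emits encInstr adjustGen e (adjustProg j) := by
  refine .seq (.sub ?_ ?_ ?_) (.seq (.loop he fun _ => .add ?_ ?_ ?_)
    (.cons (.max ?_ ?_ ?_) (.min ?_ ?_ ?_))) <;> simp [num, Reg.addr, he, hj]

theorem emits_minimumGen {e : Var → ℕ} (he : e .size = n) :
    Emits encInstr minimumGen e (minimumProg n) := by
  refine .seq (.add ?_ ?_ ?_) (.loop he fun _ => .min ?_ ?_ ?_) <;> simp [num, Reg.addr, he]

theorem emits_valueGen {e : Var → ℕ} (he : e .size = n) {i : Fin n} (hi : e .agent = i) :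
    Emits encInstr valueGen e (valueProg i) := by
  refine .seq (.add ?_ ?_ ?_) (.seq (.loop he fun _ => .cons (.mul ?_ ?_ ?_) (.add ?_ ?_ ?_))
    (.seq (.sub ?_ ?_ ?_) (.seq (.loop he fun _ => .cons (.mul ?_ ?_ ?_) (.add ?_ ?_ ?_))
    (.max ?_ ?_ ?_)))) <;> simp [num, Reg.addr, he, hi]

theorem emits_mixGen {e : Var → ℕ} (he : e .size = n) {i b c : Fin n} (hi : e .agent = i)
    (hb : e .low = b) (hc : e .high = c) : Emits encInstr mixGen e (mixProg i b c) := by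
  refine .cons (.sub ?_ ?_ ?_) <| .cons (.max ?_ ?_ ?_) <| .cons (.sub ?_ ?_ ?_) <|
    .cons (.mul ?_ ?_ ?_) <| .cons (.sub ?_ ?_ ?_) <| .cons (.mul ?_ ?_ ?_) <|
    .cons (.add ?_ ?_ ?_) <| .cons (.max ?_ ?_ ?_) <| .cons (.add ?_ ?_ ?_) <|
    .cons (.mul ?_ ?_ ?_) <| .cons (.mul ?_ ?_ ?_) <| .cons (.add ?_ ?_ ?_) <|
    .cons (.add ?_ ?_ ?_) <| .cons (.mul ?_ ?_ ?_) <| .cons (.add ?_ ?_ ?_) <|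
    .add ?_ ?_ ?_ <;> simp [num, Reg.addr, he, hi, hb, hc]

theorem emits_mixesGen {e : Var → ℕ} (he : e .size = n) {i b : Fin n} (hi : e .agent = i)
    (hb : e .low = b) : Emits encInstr mixesGen e (mixesProg i b) := by
  refine .seq (.cons (.sub ?_ ?_ ?_) (.max ?_ ?_ ?_))
    (.loop he fun c => emits_mixGen ?_ ?_ ?_ ?_) <;> simp [num, Reg.addr, he, hi, hb]

theorem emits_agentGen {e : Var → ℕ} (he : e .size = n) {i : Fin n} (hi : e .agent = i) :
    Emits encInstr agentGen e (agentProg i) := by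
  refine .seq (emits_valueGen he hi) (.seq (.add ?_ ?_ ?_) (.seq (.loop he fun _ => .add ?_ ?_ ?_)
    (.seq (.loop he fun b => emits_mixesGen ?_ ?_ ?_) (.loop he fun _ => .div ?_ ?_ ?_)))) <;>
    simp [num, Reg.addr, he, hi]

theorem emits_mainGen {e : Var → ℕ} (he : e .size = n) :
    Emits encInstr mainGen e (mainProg n) := by
  refine .seq (emits_constProgGen he) (.seq (.loop he fun _ => emits_adjustGen ?_ ?_)
    (.seq (emits_minimumGen he) (.seq (.loop he fun _ => emits_agentGen ?_ ?_)
    (.loop he fun _ => .sub ?_ ?_ ?_)))) <;> simp [num, Reg.addr, he]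

/-! ### The generator of the linear system -/

/-- Generates a term of a linear inequality. -/
def termGen (r : VReg) (q : SmallRat) : Gen := (Gen.tok .item).seq (r.unary.seq q.gen)

/-- Generates an inequality, given a generator of its terms. -/
def ineqGen (terms : Gen) (q : SmallRat) : Gen :=
  (Gen.tok .item).seq ((terms.seq (.tok .sep)).seq q.gen)

/-- Generates `domainIneqs`. -/
def domainGen : Gen :=
  (Gen.loop .low .size
    ((ineqGen (termGen (P .low) .neg) .zero).seq
      (ineqGen ((termGen (P .low) .one).seq (.loop .agent .size (.loop .good .size
        (termGen (X .agent .good) .neg)))) .zero))).seq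
  (.loop .agent .size
    ((Gen.loop .good .size (ineqGen (termGen (X .agent .good) .neg) .zero)).seq
      ((ineqGen (.loop .good .size (termGen (X .agent .good) .one)) .one).seq
        (ineqGen (.loop .good .size (termGen (X .agent .good) .neg)) .neg))))

theorem emits_termGen {e : Var → ℕ} {r : VReg} {q : SmallRat} {k : ℕ} {c : ℚ} (hr : r.num e = k)
    (hq : q.toRat = c) :
    Emits (fun t : ℕ × ℚ => encUnary t.1 ++ encRat t.2) (termGen r q) e [(k, c)] := by
  subst hr hq
  simp [Emits, termGen, Gen.word, word_unary, SmallRat.word_gen]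

theorem emits_ineqGen {e : Var → ℕ} {terms : Gen} {q : SmallRat} {l : List (ℕ × ℚ)} {c : ℚ}
    (hl : Emits (fun t : ℕ × ℚ => encUnary t.1 ++ encRat t.2) terms e l) (hq : q.toRat = c) :
    Emits encLinIneq (ineqGen terms q) e [⟨l, c⟩] := by
  subst hq
  rw [Emits, ineqGen, Gen.word, Gen.word, Gen.word, hl.sep, SmallRat.word_gen]
  simp [encLinIneq]

theorem emits_domainGen {e : Var → ℕ} (he : e .size = n) :
    Emits encLinIneq domainGen e (domainIneqs n) := by
  refine .seq (.loop he fun j => .cons (emits_ineqGen (emits_termGen ?_ ?_) ?_)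
    (emits_ineqGen (.seq (emits_termGen ?_ ?_) (.loop ?_ fun _ => .loop ?_ fun _ =>
      emits_termGen ?_ ?_)) ?_))
    (.loop he fun i => .seq (.loop ?_ fun _ => emits_ineqGen (emits_termGen ?_ ?_) ?_)
      (.cons (emits_ineqGen (.loop ?_ fun _ => emits_termGen ?_ ?_) ?_)
        (emits_ineqGen (.loop ?_ fun _ => emits_termGen ?_ ?_) ?_))) <;>
    simp [num, Reg.addr, he, SmallRat.toRat]

/-! ### The utilities -/

/-- Generates the beginning of an instruction that loads a utility. -/
def utilityGen : Gen :=
  -- The instruction stops after its register; the rational that completes it is copied from the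
  -- input.
  (Gen.tok .item).seq ((Gen.tok .opConst).seq
    ((((marks .size).seq (marksMul .size)).seq (marks .count)).seq (.tok .sep)))

theorem word_utilityGen (n k : ℕ) :
    utilityGen.word (baseEnv n k) = .item :: .opConst :: encUnary (n + n * n + k) := by
  simp only [utilityGen, Gen.word, word_marks, word_marksMul, baseEnv, encUnary,
    List.replicate_append_replicate, List.singleton_append]

/-- The utilities, row by row. -/
def ratsOf (I : HZInstance) : List ℚ :=
  (List.finRange I.1).flatMap fun i => (List.finRange I.1).map fun j => I.2 i j

theorem encHZ_eq (I : HZInstance) : encHZ I = encUnary I.1 ++ (ratsOf I).flatMap encRat := by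
  simp only [encHZ, ratsOf, List.flatMap_assoc, List.flatMap_map]

theorem flatMap_finRange_eq_ofFn {α : Type} (f : Fin n → Fin n → α) :
    ((List.finRange n).flatMap fun i => (List.finRange n).map fun j => f i j) =
      List.ofFn fun k : Fin (n * n) => f k.divNat k.modNat := by
  rw [List.ofFn_mul, List.flatMap_def, List.ofFn_eq_map]
  congr 1
  refine List.map_congr_left fun i _ => ?_
  rw [List.ofFn_eq_map]
  refine List.map_congr_left fun j _ => ?_
  have h := finProdFinEquiv.symm_apply_apply (i, j)
  have h' : (⟨i * n + j, mul_add_lt_mul i j⟩ : Fin (n * n)) = finProdFinEquiv (i, j) :=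
    Fin.ext (by simp only [finProdFinEquiv_apply_val]; ring)
  rw [h']
  exact congrArg (fun a : Fin n × Fin n => f a.1 a.2) h.symm

/-- The counter `k` of rationals read matches the row-by-row register `U i j` with `i = k / n` and
`j = k % n`. -/
theorem ratsWord_ratsOf (I : HZInstance) :
    ratsWord utilityGen I.1 0 (ratsOf I) =
      (utilityProg I.2).flatMap fun c => Tok.item :: encInstr c := by
  obtain ⟨n, u⟩ := I
  have h1 : utilityProg u = ((ratsOf ⟨n, u⟩).zipIdx 0).map fun a =>
      Instr.const (n + n * n + a.2) a.1 := by
    have h2 : utilityProg u = (List.finRange n).flatMap fun i => (List.finRange n).map fun j =>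
        Instr.const (Reg.U i j).addr (u i j) := by
      simp only [utilityProg, List.map_eq_flatMap]
    rw [h2, ratsOf, flatMap_finRange_eq_ofFn, flatMap_finRange_eq_ofFn]
    refine List.ext_getElem (by simp) fun k hk _ => ?_
    simp [Reg.addr, Nat.div_add_mod']
  rw [h1, List.flatMap_map, ratsWord]
  refine List.flatMap_congr fun a _ => ?_
  simp [word_utilityGen, encInstr]

/-! ### Membership in FIXP -/

theorem hzProblem_inFIXPOn : hzProblem.InFIXPOn hzDomain := by
  let A := domainGen.seq (.tok .sep)
  let C := mainGen.seq (.tok .sep)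
  have hword : ∀ I : HZInstance, encOutput (domainIneqs I.1, hzProg I) =
      tableWord A utilityGen C I.1 (ratsOf I) := by
    intro I
    have he : baseEnv I.1 0 .size = I.1 := rfl
    rw [tableWord, (emits_domainGen he).sep, ratsWord_ratsOf, (emits_mainGen he).sep, encOutput,
      hzProg, encList_eq encInstr, encList_eq encInstr, List.flatMap_append]
    simp only [List.append_assoc]
  obtain ⟨hTM, hlen⟩ := computable_of_tableWord (A := A) (B := utilityGen) (C := C) (by rfl)
    (by rfl) (by rfl) (g := fun I : HZInstance => (domainIneqs I.1, hzProg I)) (fun I => I.1)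
    ratsOf encHZ_eq hword
  refine ⟨fun I => (domainIneqs I.1, hzProg I), hTM, ⟨_, fun I => le_trans ?_ (hlen I)⟩,
    fun I => ⟨hzDomain_eq_polyhedron I, hzDomain_nonempty I, hzDomain_isCompact I,
      hzDomain_convex I, fun v _ => (hzProg_spec I v).1, hzProg_mapsTo I,
      SLP.continuousOn_fn _ fun v _ => (hzProg_spec I v).1,
      fun v hv hfix => hzProg_fixed I hv hfix⟩⟩
  -- Each instruction contributes at least one token, so the bound for the output word also bounds
  -- the length of the program.
  have h : ∀ L : SLP, L.length ≤ (encList encInstr L).length := by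
    intro L
    induction L with
    | nil => simp
    | cons c L ih => simp only [encList, List.length_cons, List.length_append]; omega
  rw [encOutput, List.length_append]
  exact (h _).trans (Nat.le_add_left _ _)

end FixpHZ

/-- Computing a Hylland-Zeckhauser equilibrium is in FIXP; the fixed points can be taken over the
domain of all prices in `[0, n]` and all allocations of one unit to every agent. -/
theorem mainTheorem4 :
    FixpHZ.hzProblem.InFIXP ∧ FixpHZ.hzProblem.InFIXPOn FixpHZ.hzDomain :=
  ⟨⟨_, FixpHZ.hzProblem_inFIXPOn⟩, FixpHZ.hzProblem_inFIXPOn⟩
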